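/- All graphs are finite and simple, and $d\ge 1$ is an integer. A realization of a graph $G=(V,E)$ in $\mathbb R^d$ or $\mathbb C^d$ is a map $\rho$ from $V$ to that space; it is generic if its $d|V|$ coordinates are algebraically independent over $\mathbb Q$. The graph $G$ is $d$-rigid if for every generic $\rho\colon V\to\mathbb R^d$ there is $\varepsilon>0$ such that every $\rho'\colon V\to\mathbb R^d$ with $\|\rho'(u)-\rho'(v)\|=\|\rho(u)-\rho(v)\|$ for all $uv\in E$ and $\|\rho(v)-\rho'(v)\|<\varepsilon$ for all $v\in V$ satisfies $\|\rho'(u)-\rho'(v)\|=\|\rho(u)-\rho(v)\|$ for all $u,v\in V$. It is minimally $d$-rigid if it is $d$-rigid and the deletion of any edge yields a graph that is not $d$-rigid. For $x\in\mathbb C^d$ put $q(x)=\sum_{i=1}^d x_i^2$. Two complex realizations $\rho,\sigma\colon V\to\mathbb C^d$ are equivalent if $q(\sigma(u)-\sigma(v))=q(\rho(u)-\rho(v))$ for all $uv\in E$. They are identified if they differ by a direct isometry, that is, if there are $A\in\mathbb C^{d\times d}$ with $A^{T}A=I$, $\det A=1$, and $t\in\mathbb C^d$ such that $\sigma(v)=A\rho(v)+t$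 for all $v\in V$ (so reflections count as different). The realization number $c_d(G)$ is the number of complex realizations equivalent to a generic complex realization $\rho$ of $G$, counted up to direct isometries. **Lemma.** Let $G$ be a minimally $d$-rigid graph and let $H$ be a minimally $d$-rigid proper subgraph of $G$ with at least $d$ vertices. Then $c_d(H)$ and $c_d(G)$ are well defined (the count is finite and the same for every generic $\rho$), and $c_d(H)$ divides $c_d(G)$. -/

import Mathlib

/-! ### Rigidity over the reals -/

/-- A real realization of a vertex set in `ℝ^d` is generic if all its coordinates together are
algebraically independent over `ℚ`. -/
def IsGenericReal {V : Type*} {d : ℕ} (ρ : V → EuclideanSpace ℝ (Fin d)) : Prop :=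
  AlgebraicIndependent ℚ (fun p : V × Fin d => ρ p.1 p.2)

/-- `G` is (generically) `d`-rigid: for every generic realization `ρ` in `ℝ^d`, each equivalent
realization (same edge lengths) close enough to `ρ` is congruent to `ρ` (same distances between
all pairs of vertices). -/
def IsRigid {V : Type*} (d : ℕ) (G : SimpleGraph V) : Prop :=
  ∀ ρ : V → EuclideanSpace ℝ (Fin d), IsGenericReal ρ →
    ∃ ε : ℝ, 0 < ε ∧ ∀ ρ' : V → EuclideanSpace ℝ (Fin d),
      (∀ u v, G.Adj u v → ‖ρ' u - ρ' v‖ = ‖ρ u - ρ v‖) →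
      (∀ v, ‖ρ v - ρ' v‖ < ε) →
      ∀ u v, ‖ρ' u - ρ' v‖ = ‖ρ u - ρ v‖

/-- `G` is minimally `d`-rigid: it is `d`-rigid, and deleting any edge destroys this. -/
def IsMinimallyRigid {V : Type*} (d : ℕ) (G : SimpleGraph V) : Prop :=
  IsRigid d G ∧ ∀ e ∈ G.edgeSet, ¬ IsRigid d (G.deleteEdges {e})

/-! ### Counting complex realizations -/

/-- The quadratic form `x₁² + ⋯ + x_d²` on `ℂ^d` (no complex conjugation). -/
def sqNorm {d : ℕ} (x : Fin d → ℂ) : ℂ := ∑ i, x i ^ 2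

/-- A complex realization in `ℂ^d` is generic if all its coordinates together are algebraically
independent over `ℚ`. -/
def IsGenericComplex {V : Type*} {d : ℕ} (ρ : V → Fin d → ℂ) : Prop :=
  AlgebraicIndependent ℚ (fun p : V × Fin d => ρ p.1 p.2)

/-- The complex realizations of `G` equivalent to `ρ`, i.e. with the same (squared) edge
lengths. -/
def EquivalentRealization {V : Type*} {d : ℕ} (G : SimpleGraph V) (ρ : V → Fin d → ℂ) : Type _ :=
  {σ : V → Fin d → ℂ // ∀ u v, G.Adj u v → sqNorm (σ u - σ v) = sqNorm (ρ u - ρ v)}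

/-- Two complex realizations are directly congruent if they differ by a direct isometry
`x ↦ A x + t` of `ℂ^d`, with `A` orthogonal (`Aᵀ A = 1`) of determinant `1`. In particular
mirror images are in general different. -/
def DirectlyCongruent {V : Type*} {d : ℕ} (ρ σ : V → Fin d → ℂ) : Prop :=
  ∃ (A : Matrix (Fin d) (Fin d) ℂ) (t : Fin d → ℂ),
    A.transpose * A = 1 ∧ A.det = 1 ∧ ∀ v, σ v = A.mulVec (ρ v) + t

theorem DirectlyCongruent.refl {V : Type*} {d : ℕ} (ρ : V → Fin d → ℂ) :
    DirectlyCongruent ρ ρ :=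
  ⟨1, 0, by simp, by simp, by simp⟩

theorem DirectlyCongruent.symm {V : Type*} {d : ℕ} {ρ σ : V → Fin d → ℂ}
    (h : DirectlyCongruent ρ σ) : DirectlyCongruent σ ρ := by
  obtain ⟨A, t, hA, hdet, h⟩ := h
  refine ⟨A.transpose, -(A.transpose.mulVec t), ?_, by simpa using hdet, fun v => ?_⟩
  · rw [Matrix.transpose_transpose]
    exact mul_eq_one_comm.mp hA
  · rw [h v, Matrix.mulVec_add, Matrix.mulVec_mulVec, hA, Matrix.one_mulVec]
    abel

theorem DirectlyCongruent.trans {V : Type*} {d : ℕ} {ρ σ τ : V → Fin d → ℂ}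
    (h : DirectlyCongruent ρ σ) (h' : DirectlyCongruent σ τ) : DirectlyCongruent ρ τ := by
  obtain ⟨A, t, hA, hdet, h⟩ := h
  obtain ⟨B, s, hB, hdet', h'⟩ := h'
  refine ⟨B * A, B.mulVec t + s, ?_, by simp [hdet, hdet'], fun v => ?_⟩
  · rw [Matrix.transpose_mul, Matrix.mul_assoc, ← Matrix.mul_assoc B.transpose, hB,
      Matrix.one_mul, hA]
  · rw [h' v, h v, Matrix.mulVec_add, Matrix.mulVec_mulVec, add_assoc]

/-- Direct congruence on the set of realizations of `G` equivalent to `ρ`. -/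
def congruenceSetoid {V : Type*} {d : ℕ} (G : SimpleGraph V) (ρ : V → Fin d → ℂ) :
    Setoid (EquivalentRealization G ρ) where
  r σ τ := DirectlyCongruent σ.1 τ.1
  iseqv := ⟨fun σ => .refl σ.1, fun h => h.symm, fun h h' => h.trans h'⟩

/-- The realizations of `G` with the same edge lengths as `ρ`, up to direct isometries. -/
abbrev RealizationClass {V : Type*} {d : ℕ} (G : SimpleGraph V) (ρ : V → Fin d → ℂ) : Type _ :=
  Quotient (congruenceSetoid G ρ)

/-- The number `c` is the number of complex realizations of `G` in `ℂ^d`: for every generic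
complex realization `ρ`, there are, up to direct isometries, finitely many realizations equivalent
to `ρ`, and exactly `c` of them. -/
def IsRealizationNumber {V : Type*} (d : ℕ) (G : SimpleGraph V) (c : ℕ) : Prop :=
  ∀ ρ : V → Fin d → ℂ, IsGenericComplex ρ →
    Finite (RealizationClass G ρ) ∧ Nat.card (RealizationClass G ρ) = c

/-- The complex realization number `c_d(G)`: the number of classes of realizations equivalent to a
generic complex realization. It is written as an infimum over the generic realizations; all of
these give the same finite value whenever `IsRealizationNumber d G (realizationNumber d G)`. -/
noncomputable def realizationNumber {V : Type*} (d : ℕ) (G : SimpleGraph V) : ℕ :=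
  sInf {c : ℕ | ∃ ρ : V → Fin d → ℂ, IsGenericComplex ρ ∧ c = Nat.card (RealizationClass G ρ)}

/-!
The realization number is governed by the automorphisms of the field `ℂ`, which act on realizations
coordinatewise and preserve direct congruence. Any two finite algebraically independent families of
complex numbers are conjugate under such an automorphism
(`exists_ringEquiv_of_algebraicIndependent`), so any two generic realizations have equally
many classes.

Real rigidity enters through two algebraic consequences. If `G` is minimally rigid, then its squared
edge lengths at a generic point are algebraically independent
(`IsMinimallyRigid.algebraicIndependent_lengthPoly`): an edge length algebraic over the other ones
takes only finitely many values on their fibre, hence is locally constant there, and the edge could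
be deleted. If `G` is rigid, then it has at least `rigidRank n d = d n - d (d + 1) / 2` edges
(`IsRigid.rigidRank_le_card_edgeSet`): by the Jacobian criterion (`surjective_polyDifferential`) and
the open mapping property of submersions, all lengths of pairs are algebraic over the edge lengths,
and `rigidRank n d` lengths of pairs are algebraically independent.

The key step is transitivity (`exists_ringEquiv_directlyCongruent`): every realization `σ`
equivalent to a generic `ρ` is directly congruent to a conjugate of `ρ`. An affine basis of `σ` among
its vertices provides parameters, namely the Gram matrix of the basis and the affine coordinates of the
other vertices. The edge lengths are polynomials in the parameters, and there are at most as many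
parameters as edges, so the parameters are algebraically independent; the same holds for `ρ`. An
automorphism matching the parameters matches the realizations up to an isometry, and the orientation
is corrected by an automorphism that takes `ρ` to its mirror image. Since the parameters of `ρ` are
algebraic over the edge lengths, they have finitely many conjugates, which proves finiteness
(`finite_realizationClass`).

For a subgraph `H` the automorphism can moreover be chosen to fix the lengths of the edges outside
`H`. It then permutes the realizations of `G`, and maps the fibre of the restriction map over one
class of realizations of `H` onto the fibre over another (`nonempty_fiber_equiv`). All fibres are
equipotent, which is the divisibility.
-/

/-! ### Algebraic independence over the rationals -/

section AlgebraicIndependence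

variable {K : Type*} [Field K] [CharZero K]

/-- The relative algebraic closure in `K` of the field generated over `ℚ` by the set `s`. -/
noncomputable def algClosureOver (s : Set K) : IntermediateField ℚ K :=
  (algebraicClosure (IntermediateField.adjoin ℚ s) K).restrictScalars ℚ

theorem mem_algClosureOver_iff {s : Set K} {x : K} :
    x ∈ algClosureOver s ↔ IsAlgebraic (Algebra.adjoin ℚ s) x := by
  rw [← IntermediateField.isAlgebraic_adjoin_iff, algClosureOver,
    IntermediateField.mem_restrictScalars, mem_algebraicClosure_iff]

theorem coe_algClosureOver (s : Set K) :
    (algClosureOver s : Set K) = (AlgebraicIndependent.matroid ℚ K).closure s := by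
  ext x
  rw [AlgebraicIndependent.matroid_closure_eq]
  exact mem_algClosureOver_iff

theorem subset_algClosureOver (s : Set K) : s ⊆ algClosureOver s := by
  rw [coe_algClosureOver]
  exact Matroid.subset_closure _ _ (Set.subset_univ _)

theorem algClosureOver_le {s t : Set K} (h : s ⊆ algClosureOver t) :
    algClosureOver s ≤ algClosureOver t := by
  rw [← SetLike.coe_subset_coe]
  rw [coe_algClosureOver] at *
  rw [coe_algClosureOver]
  exact Matroid.closure_subset_closure_of_subset_closure h

theorem mem_algClosureOver_of_sq_mem {s : Set K} {x : K} (h : x ^ 2 ∈ algClosureOver s) :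
    x ∈ algClosureOver s := by
  rw [mem_algClosureOver_iff] at *
  exact h.of_pow two_pos

theorem AlgebraicIndependent.indep_range {ι : Type*} {x : ι → K} (h : AlgebraicIndependent ℚ x) :
    (AlgebraicIndependent.matroid ℚ K).Indep (Set.range x) :=
  h.coe_range

theorem algebraicIndependent_of_indep_range {ι : Type*} {x : ι → K} (hx : Function.Injective x)
    (h : (AlgebraicIndependent.matroid ℚ K).Indep (Set.range x)) : AlgebraicIndependent ℚ x :=
  (algebraicIndependent_subtype_range hx).1 h

theorem AlgebraicIndependent.encard_range {ι : Type*} [Finite ι] {x : ι → K}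
    (h : AlgebraicIndependent ℚ x) : (Set.range x).encard = Nat.card ι := by
  rw [← Set.image_univ, h.injective.encard_image, Set.encard_univ, ENat.card_eq_coe_natCard]

theorem encard_range_le {α ι : Type*} [Finite ι] (x : ι → α) :
    (Set.range x).encard ≤ Nat.card ι := by
  rw [← Set.image_univ, ← ENat.card_eq_coe_natCard, ← Set.encard_univ]
  exact Set.encard_image_le _ _

/-- An algebraically independent family lying in the algebraic closure of the field generated by a
finite family `y` is at most as large as `y`. -/
theorem AlgebraicIndependent.card_le_of_subset {ι κ : Type*} [Finite ι] [Finite κ] {x : ι → K}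
    {y : κ → K} (hx : AlgebraicIndependent ℚ x)
    (hxy : ∀ i, x i ∈ algClosureOver (Set.range y)) : Nat.card ι ≤ Nat.card κ := by
  have h1 : Set.range x ⊆ (AlgebraicIndependent.matroid ℚ K).closure (Set.range y) := by
    rw [← coe_algClosureOver]
    rintro _ ⟨i, rfl⟩
    exact hxy i
  have h2 := hx.indep_range.encard_le_eRk_of_subset h1
  rw [Matroid.eRk_closure_eq, hx.encard_range] at h2
  exact_mod_cast h2.trans ((Matroid.eRk_le_encard _ _).trans (encard_range_le y))

/-- A finite family `y` whose algebraic closure contains an algebraically independent family `x` of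
at least the same size is algebraically independent. -/
theorem AlgebraicIndependent.of_card_le {ι κ : Type*} [Finite ι] [Finite κ] {x : ι → K}
    {y : κ → K} (hx : AlgebraicIndependent ℚ x)
    (hxy : ∀ i, x i ∈ algClosureOver (Set.range y)) (hcard : Nat.card κ ≤ Nat.card ι) :
    AlgebraicIndependent ℚ y := by
  have h1 : Set.range x ⊆ (AlgebraicIndependent.matroid ℚ K).closure (Set.range y) := by
    rw [← coe_algClosureOver]
    rintro _ ⟨i, rfl⟩
    exact hxy i
  have h2 := hx.indep_range.encard_le_eRk_of_subset h1
  rw [Matroid.eRk_closure_eq, hx.encard_range] at h2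
  have h3 : (Nat.card κ : ℕ∞) ≤ (AlgebraicIndependent.matroid ℚ K).eRk (Set.range y) :=
    le_trans (by exact_mod_cast hcard) h2
  have hfin : (Set.range y).Finite := Set.finite_range y
  apply algebraicIndependent_of_indep_range
  · have h4 : (Nat.card κ : ℕ∞) ≤ (Set.range y).encard := h3.trans (Matroid.eRk_le_encard _ _)
    rw [← hfin.cast_ncard_eq] at h4
    have h5 : Nat.card κ ≤ (Set.range y).ncard := by exact_mod_cast h4
    rw [← Nat.card_coe_set_eq] at h5
    have h6 := Set.rangeFactorization_surjective.bijective_of_nat_card_le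
      (f := Set.rangeFactorization y) h5
    exact fun i j hij => h6.1 (Subtype.ext hij)
  · refine ((AlgebraicIndependent.matroid ℚ K).isRkFinite_of_finite hfin).indep_of_encard_le_eRk ?_
    exact (encard_range_le y).trans h3

/-- If an algebraically independent finite family `x` lies in the algebraic closure of the field
generated by `y`, and `y` is not larger, then conversely `y` is algebraic over `x`. -/
theorem AlgebraicIndependent.mem_algClosureOver_of_card_le {ι κ : Type*} [Finite ι] [Finite κ]
    {x : ι → K} {y : κ → K} (hx : AlgebraicIndependent ℚ x)
    (hxy : ∀ i, x i ∈ algClosureOver (Set.range y)) (hcard : Nat.card κ ≤ Nat.card ι) (k : κ) :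
    y k ∈ algClosureOver (Set.range x) := by
  have h1 : Set.range x ⊆ (AlgebraicIndependent.matroid ℚ K).closure (Set.range y) := by
    rw [← coe_algClosureOver]
    rintro _ ⟨i, rfl⟩
    exact hxy i
  have h2 := Matroid.IsRkFinite.closure_eq_closure_of_subset_of_eRk_ge_eRk
    ((AlgebraicIndependent.matroid ℚ K).isRkFinite_of_finite (Set.finite_range x)) h1 (by
      rw [Matroid.eRk_closure_eq, hx.indep_range.eRk_eq_encard, hx.encard_range]
      refine (Matroid.eRk_le_encard _ _).trans ((encard_range_le y).trans ?_)
      exact_mod_cast hcard)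
  rw [Matroid.closure_closure, ← coe_algClosureOver, ← coe_algClosureOver] at h2
  rw [← SetLike.mem_coe, h2]
  exact subset_algClosureOver _ ⟨k, rfl⟩

/-- The values of polynomials at a generic point are algebraically independent if and only if the
polynomials are. -/
theorem algebraicIndependent_aeval_iff {σ ι : Type*} {x : σ → K} (hx : AlgebraicIndependent ℚ x)
    (P : ι → MvPolynomial σ ℚ) :
    AlgebraicIndependent ℚ (fun i => MvPolynomial.aeval x (P i)) ↔ AlgebraicIndependent ℚ P :=
  AlgHom.algebraicIndependent_iff (MvPolynomial.aeval x)
    (algebraicIndependent_iff_injective_aeval.1 hx)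

end AlgebraicIndependence

/-- Two finite algebraically independent families of complex numbers are conjugate under an
automorphism of the field `ℂ`. -/
theorem exists_ringEquiv_of_algebraicIndependent {ι : Type*} [Finite ι] {x y : ι → ℂ}
    (hx : AlgebraicIndependent ℚ x) (hy : AlgebraicIndependent ℚ y) :
    ∃ γ : ℂ ≃+* ℂ, ∀ i, γ (x i) = y i := by
  obtain ⟨s, hxs, hs⟩ := exists_isTranscendenceBasis_superset hx.coe_range
  obtain ⟨t, hyt, ht⟩ := exists_isTranscendenceBasis_superset hy.coe_range
  have hcard : ∀ u : Set ℂ, IsTranscendenceBasis ℚ ((↑) : u → ℂ) →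
      Cardinal.mk u = Cardinal.continuum := by
    intro u hu
    have := IsAlgClosed.cardinal_eq_cardinal_transcendence_basis_of_aleph0_lt _ hu
      (by simp) (by rw [Cardinal.mk_complex]; exact Cardinal.aleph0_lt_continuum)
    simpa [Cardinal.mk_complex] using this.symm
  have hsx : Function.Injective (fun i => (⟨x i, hxs ⟨i, rfl⟩⟩ : s)) := fun i j h =>
    hx.injective (congrArg Subtype.val h)
  have hty : Function.Injective (fun i => (⟨y i, hyt ⟨i, rfl⟩⟩ : t)) := fun i j h =>
    hy.injective (congrArg Subtype.val h)
  obtain ⟨e, he⟩ : ∃ e : s ≃ t, ∀ i, e ⟨x i, hxs ⟨i, rfl⟩⟩ = ⟨y i, hyt ⟨i, rfl⟩⟩ := by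
    let q := Equiv.ofInjective _ hsx
    obtain ⟨g, hg⟩ := Cardinal.extend_function_of_lt
      (q.symm.toEmbedding.trans ⟨_, hty⟩) (by
        rw [hcard s hs]
        exact (Cardinal.mk_lt_aleph0_iff.2 (Set.finite_range _)).trans Cardinal.aleph0_lt_continuum)
      (Cardinal.eq.1 ((hcard s hs).trans (hcard t ht).symm))
    refine ⟨g, fun i => ?_⟩
    have := hg (q i)
    simpa [q] using this
  let _ := IsAlgClosed.isAlgClosure_of_transcendence_basis _ hs
  let _ := IsAlgClosed.isAlgClosure_of_transcendence_basis _ ht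
  let f : Algebra.adjoin ℚ (Set.range ((↑) : s → ℂ)) ≃ₐ[ℚ]
      Algebra.adjoin ℚ (Set.range ((↑) : t → ℂ)) :=
    (hs.1.aevalEquiv.symm.trans (MvPolynomial.renameEquiv ℚ e)).trans ht.1.aevalEquiv
  have hf : ∀ u : s, (f ⟨u, Algebra.subset_adjoin ⟨u, rfl⟩⟩ : ℂ) = e u := by
    intro u
    have : hs.1.aevalEquiv.symm ⟨u, Algebra.subset_adjoin ⟨u, rfl⟩⟩ = MvPolynomial.X u := by
      rw [AlgEquiv.symm_apply_eq]
      ext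
      simp
    simp [f, this]
  refine ⟨IsAlgClosure.equivOfEquiv ℂ ℂ f.toRingEquiv, fun i => ?_⟩
  have := IsAlgClosure.equivOfEquiv_algebraMap ℂ ℂ f.toRingEquiv
    ⟨x i, Algebra.subset_adjoin ⟨⟨x i, hxs ⟨i, rfl⟩⟩, rfl⟩⟩
  refine this.trans ?_
  have h2 := hf ⟨x i, hxs ⟨i, rfl⟩⟩
  rw [he i] at h2
  exact h2

/-- There are algebraically independent families of real numbers over any finite index type. -/
theorem exists_algebraicIndependent_real (ι : Type*) [Finite ι] :
    ∃ x : ι → ℝ, AlgebraicIndependent ℚ x := by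
  obtain ⟨s, hs⟩ := exists_isTranscendenceBasis ℚ ℝ
  have hinf : Infinite s := by
    by_contra hfin
    rw [not_infinite_iff_finite] at hfin
    have hm : Countable (MvPolynomial s ℚ) := by
      rw [← Cardinal.mk_le_aleph0_iff]
      refine MvPolynomial.cardinalMk_le_max.trans ?_
      simp
    have hc : Countable (Algebra.adjoin ℚ (Set.range ((↑) : s → ℝ))) :=
      hs.1.aevalEquiv.symm.injective.countable
    have halg := hs.isAlgebraic
    have h1 := Algebra.IsAlgebraic.cardinalMk_le_max
      (Algebra.adjoin ℚ (Set.range ((↑) : s → ℝ))) ℝ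
    rw [max_eq_right (Cardinal.mk_le_aleph0_iff.2 hc), Cardinal.mk_real] at h1
    exact absurd h1 (not_le_of_gt Cardinal.aleph0_lt_continuum)
  let f : ι → s := fun i => Infinite.natEmbedding s (Finite.equivFin ι i)
  have hf : Function.Injective f := fun i j h => by simpa [f, Fin.val_inj] using h
  exact ⟨fun i => f i, hs.1.comp f hf⟩

/-! ### Polynomial relations and the Jacobian criterion -/

section Relations

open Polynomial in
/-- An element algebraic over a domain of characteristic zero is a root of a polynomial whose
derivative does not vanish there. -/
theorem IsAlgebraic.exists_aeval_derivative_ne_zero {A K : Type*} [CommRing A] [IsDomain A]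
    [CharZero A] [CommRing K] [Algebra A K] [FaithfulSMul A K] {a : K} (h : IsAlgebraic A a) :
    ∃ F : A[X], aeval a F = 0 ∧ aeval a (derivative F) ≠ 0 := by
  obtain ⟨F, hF0, hF⟩ := h
  induction hn : F.natDegree using Nat.strong_induction_on generalizing F with
  | _ n ih =>
    by_cases hd : aeval a (derivative F) = 0
    · have hdeg : F.natDegree ≠ 0 := by
        intro h0
        rw [eq_C_of_natDegree_eq_zero h0, aeval_C] at hF
        rw [FaithfulSMul.algebraMap_eq_zero_iff] at hF
        rw [eq_C_of_natDegree_eq_zero h0, hF, C_0] at hF0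
        exact hF0 rfl
      refine ih _ ?_ (derivative F) (fun h0 => hdeg ?_) hd rfl
      · rw [← hn]
        exact natDegree_derivative_lt hdeg
      · exact derivative_eq_zero.1 h0
    · exact ⟨F, hF, hd⟩

variable {K : Type*} [Field K] [CharZero K] {σ κ : Type*}

/-- If the value of the polynomial `p` at a generic point `x` is algebraic over the values of the
polynomials `P k`, then there is a polynomial identity `F(p, P) = 0` that is separable in its
first variable at `x`. -/
theorem exists_polynomial_relation {x : σ → K} (hx : AlgebraicIndependent ℚ x)
    (P : κ → MvPolynomial σ ℚ) (p : MvPolynomial σ ℚ)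
    (h : MvPolynomial.aeval x p ∈
      algClosureOver (Set.range fun k => MvPolynomial.aeval x (P k))) :
    ∃ F : Polynomial (MvPolynomial κ ℚ),
      F.eval₂ (MvPolynomial.aeval P : MvPolynomial κ ℚ →ₐ[ℚ] _).toRingHom p = 0 ∧
      (Polynomial.derivative F).eval₂
        (MvPolynomial.aeval fun k => MvPolynomial.aeval x (P k) :
      MvPolynomial κ ℚ →ₐ[ℚ] _).toRingHom
        (MvPolynomial.aeval x p) ≠ 0 := by
  set y : κ → K := fun k => MvPolynomial.aeval x (P k) with hy
  rw [mem_algClosureOver_iff] at h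
  obtain ⟨F, hF, hF'⟩ := h.exists_aeval_derivative_ne_zero
  have hmem : ∀ q, MvPolynomial.aeval y q ∈ Algebra.adjoin ℚ (Set.range y) := fun q => by
    rw [Algebra.adjoin_range_eq_range_aeval]
    exact ⟨q, rfl⟩
  let π := ((MvPolynomial.aeval y).codRestrict (Algebra.adjoin ℚ (Set.range y)) hmem).toRingHom
  have hπ : Function.Surjective π := by
    rintro ⟨a, ha⟩
    have ha' := ha
    rw [Algebra.adjoin_range_eq_range_aeval] at ha'
    obtain ⟨q, hq⟩ := ha'
    exact ⟨q, Subtype.ext hq⟩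
  have hev : ∀ (Q : Polynomial (MvPolynomial κ ℚ)) (a : K),
      Q.eval₂ (MvPolynomial.aeval y).toRingHom a = Polynomial.aeval a (Q.map π) := by
    intro Q a
    rw [Polynomial.aeval_def, Polynomial.eval₂_map]
    rfl
  obtain ⟨Q, rfl⟩ := Polynomial.map_surjective π hπ F
  refine ⟨Q, ?_, ?_⟩
  · apply algebraicIndependent_iff_injective_aeval.1 hx
    have := Polynomial.hom_eval₂ Q (MvPolynomial.aeval P : MvPolynomial κ ℚ →ₐ[ℚ] _).toRingHom
      (MvPolynomial.aeval x : MvPolynomial σ ℚ →ₐ[ℚ] K).toRingHom p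
    rw [map_zero]
    refine this.trans ?_
    have hc : (MvPolynomial.aeval x : MvPolynomial σ ℚ →ₐ[ℚ] K).toRingHom.comp
        (MvPolynomial.aeval P : MvPolynomial κ ℚ →ₐ[ℚ] _).toRingHom =
          (MvPolynomial.aeval y).toRingHom := by
      ext k <;> simp [hy]
    rw [hc]
    exact (hev _ _).trans hF
  · rw [hev, ← Polynomial.derivative_map]
    exact hF'

/-- A polynomial identity specializes to every point of every `ℚ`-algebra. -/
theorem eval₂_relation_eq_zero {P : κ → MvPolynomial σ ℚ} {p : MvPolynomial σ ℚ}
    {F : Polynomial (MvPolynomial κ ℚ)}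
    (hF : F.eval₂ (MvPolynomial.aeval P : MvPolynomial κ ℚ →ₐ[ℚ] _).toRingHom p = 0)
    {B : Type*} [CommRing B] [Algebra ℚ B] (z : σ → B) :
    F.eval₂ (MvPolynomial.aeval fun k => MvPolynomial.aeval z (P k) :
      MvPolynomial κ ℚ →ₐ[ℚ] _).toRingHom
      (MvPolynomial.aeval z p) = 0 := by
  have := Polynomial.hom_eval₂ F (MvPolynomial.aeval P : MvPolynomial κ ℚ →ₐ[ℚ] _).toRingHom
    (MvPolynomial.aeval z : MvPolynomial σ ℚ →ₐ[ℚ] B).toRingHom p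
  rw [hF, map_zero] at this
  rw [show (MvPolynomial.aeval fun k => MvPolynomial.aeval z (P k) :
      MvPolynomial κ ℚ →ₐ[ℚ] _).toRingHom =
    (MvPolynomial.aeval z : MvPolynomial σ ℚ →ₐ[ℚ] B).toRingHom.comp
        (MvPolynomial.aeval P : MvPolynomial κ ℚ →ₐ[ℚ] _).toRingHom by ext k <;> simp]
  exact this.symm

end Relations

section RealPoints

variable {σ κ : Type*}

theorem continuous_aeval_real (p : MvPolynomial σ ℚ) :
    Continuous fun x : σ → ℝ => MvPolynomial.aeval x p := by
  simp_rw [MvPolynomial.aeval_def, MvPolynomial.eval₂_eq_eval_map]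
  exact MvPolynomial.continuous_eval _

/-- Near a generic real point, a polynomial that is algebraic over other polynomials is constant
on their common fibre. -/
theorem eventually_aeval_eq_of_mem_algClosureOver {x : σ → ℝ} (hx : AlgebraicIndependent ℚ x)
    (P : κ → MvPolynomial σ ℚ) (p : MvPolynomial σ ℚ)
    (h : MvPolynomial.aeval x p ∈
      algClosureOver (Set.range fun k => MvPolynomial.aeval x (P k))) :
    ∀ᶠ z in nhds x, (∀ k, MvPolynomial.aeval z (P k) = MvPolynomial.aeval x (P k)) →
      MvPolynomial.aeval z p = MvPolynomial.aeval x p := by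
  obtain ⟨F, hF, hF'⟩ := exists_polynomial_relation hx P p h
  set φ := (MvPolynomial.aeval fun k => MvPolynomial.aeval x (P k) :
      MvPolynomial κ ℚ →ₐ[ℚ] _).toRingHom with hφ
  have hF0 : F.map φ ≠ 0 := by
    intro h0
    rw [Polynomial.eval₂_eq_eval_map, ← Polynomial.derivative_map, h0] at hF'
    simp at hF'
  have hfin : ((F.map φ).rootSet ℝ \ {MvPolynomial.aeval x p}).Finite :=
    ((F.map φ).rootSet_finite ℝ).sdiff
  have hopen := (continuous_aeval_real p).continuousAt.preimage_mem_nhds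
    (hfin.isClosed.isOpen_compl.mem_nhds (x := MvPolynomial.aeval x p) (by simp))
  filter_upwards [hopen] with z hz hzP
  by_contra hne
  refine hz ⟨?_, hne⟩
  rw [Polynomial.mem_rootSet]
  refine ⟨hF0, ?_⟩
  have := eval₂_relation_eq_zero hF z
  simp_rw [hzP] at this
  rw [← hφ] at this
  simpa [Polynomial.eval₂_eq_eval_map, Polynomial.aeval_def] using this

variable [Fintype σ]

/-- The differential of a polynomial function at `x`, as a linear form on tangent vectors. -/
noncomputable def polyDifferential (x : σ → ℝ) (p : MvPolynomial σ ℚ) : (σ → ℝ) →L[ℝ] ℝ :=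
  ∑ i, MvPolynomial.aeval x (MvPolynomial.pderiv i p) • ContinuousLinearMap.proj i

theorem polyDifferential_apply (x : σ → ℝ) (p : MvPolynomial σ ℚ) (ξ : σ → ℝ) :
    polyDifferential x p ξ = ∑ i, MvPolynomial.aeval x (MvPolynomial.pderiv i p) * ξ i := by
  simp [polyDifferential]

theorem polyDifferential_X (x ξ : σ → ℝ) (i : σ) :
    polyDifferential x (MvPolynomial.X i) ξ = ξ i := by
  classical
  simp [polyDifferential_apply, MvPolynomial.pderiv_X, Pi.single_apply]

theorem polyDifferential_C (x ξ : σ → ℝ) (c : ℚ) :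
    polyDifferential x (MvPolynomial.C c) ξ = 0 := by
  simp [polyDifferential_apply]

theorem polyDifferential_add (x ξ : σ → ℝ) (p q : MvPolynomial σ ℚ) :
    polyDifferential x (p + q) ξ = polyDifferential x p ξ + polyDifferential x q ξ := by
  simp [polyDifferential_apply, add_mul, Finset.sum_add_distrib]

theorem polyDifferential_mul (x ξ : σ → ℝ) (p q : MvPolynomial σ ℚ) :
    polyDifferential x (p * q) ξ = MvPolynomial.aeval x p * polyDifferential x q ξ +
      MvPolynomial.aeval x q * polyDifferential x p ξ := by
  simp only [polyDifferential_apply, Derivation.leibniz, map_add, smul_eq_mul, map_mul,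
    Finset.mul_sum, ← Finset.sum_add_distrib]
  exact Finset.sum_congr rfl fun i _ => by ring

theorem hasStrictFDerivAt_aeval (x : σ → ℝ) (p : MvPolynomial σ ℚ) :
    HasStrictFDerivAt (fun z : σ → ℝ => MvPolynomial.aeval z p) (polyDifferential x p) x := by
  induction p using MvPolynomial.induction_on with
  | C c =>
    have : polyDifferential x (MvPolynomial.C c) = 0 := by
      ext1 ξ; simp [polyDifferential_C]
    rw [this]
    simpa using hasStrictFDerivAt_const _ _
  | add p q hp hq =>
    have : polyDifferential x (p + q) = polyDifferential x p + polyDifferential x q := by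
      ext1 ξ; simp [polyDifferential_add]
    rw [this]
    simp only [map_add]
    exact hp.add hq
  | mul_X p i hp =>
    have : polyDifferential x (p * MvPolynomial.X i) =
        MvPolynomial.aeval x p • ContinuousLinearMap.proj i + x i • polyDifferential x p := by
      ext1 ξ; simp [polyDifferential_mul, polyDifferential_X]
    rw [this]
    simp only [map_mul, MvPolynomial.aeval_X]
    exact hp.mul (ContinuousLinearMap.proj (R := ℝ) (φ := fun _ : σ => ℝ) i).hasStrictFDerivAt

open TrivSqZeroExt in
/-- Evaluating at the first-order deformation `x + ε ξ` computes values and differentials. -/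
theorem aeval_dualNumber (x ξ : σ → ℝ) (p : MvPolynomial σ ℚ) :
    MvPolynomial.aeval (fun i => (inl (x i) + inr (ξ i) : DualNumber ℝ)) p =
      inl (MvPolynomial.aeval x p) + inr (polyDifferential x p ξ) := by
  induction p using MvPolynomial.induction_on with
  | C c =>
    rw [polyDifferential_C]
    simp [algebraMap_eq_inl']
  | add p q hp hq => rw [map_add, hp, hq, polyDifferential_add, map_add, inl_add, inr_add]; abel
  | mul_X p i hp =>
    rw [map_mul, hp, polyDifferential_mul, polyDifferential_X, map_mul, MvPolynomial.aeval_X,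
      MvPolynomial.aeval_X]
    ext
    · simp
    · simp [mul_comm, add_comm]

open TrivSqZeroExt in
/-- A tangent vector at a generic point that annihilates the polynomials `P k` annihilates every
polynomial algebraic over them. -/
theorem polyDifferential_eq_zero_of_mem_algClosureOver {x : σ → ℝ}
    (hx : AlgebraicIndependent ℚ x) (P : κ → MvPolynomial σ ℚ) (p : MvPolynomial σ ℚ)
    (h : MvPolynomial.aeval x p ∈
      algClosureOver (Set.range fun k => MvPolynomial.aeval x (P k)))
    {ξ : σ → ℝ} (hξ : ∀ k, polyDifferential x (P k) ξ = 0) : polyDifferential x p ξ = 0 := by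
  obtain ⟨F, hF, hF'⟩ := exists_polynomial_relation hx P p h
  have h1 := eval₂_relation_eq_zero hF x
  have h2 := eval₂_relation_eq_zero hF (fun i => (inl (x i) + inr (ξ i) : DualNumber ℝ))
  set φ := (MvPolynomial.aeval fun k => MvPolynomial.aeval x (P k) :
      MvPolynomial κ ℚ →ₐ[ℚ] _).toRingHom with hφ
  have hφ2 : (MvPolynomial.aeval fun k => MvPolynomial.aeval
      (fun i => (inl (x i) + inr (ξ i) : DualNumber ℝ)) (P k) :
      MvPolynomial κ ℚ →ₐ[ℚ] _).toRingHom =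
      (inlHom ℝ ℝ).comp φ := by
    refine MvPolynomial.ringHom_ext (fun c => ?_) fun k => ?_
    · simp [hφ, algebraMap_eq_inl']
    · simp only [hφ, AlgHom.toRingHom_eq_coe, RingHom.coe_coe, RingHom.comp_apply,
        MvPolynomial.aeval_X, aeval_dualNumber, hξ, inr_zero, add_zero]
      rfl
  have key : ∀ (G : Polynomial (MvPolynomial κ ℚ)) (a : ℝ),
      G.eval₂ ((inlHom ℝ ℝ).comp φ) (inl a) = inl (G.eval₂ φ a) := fun G a =>
    (Polynomial.hom_eval₂ G φ (inlHom ℝ ℝ) a).symm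
  rw [hφ2, aeval_dualNumber, Polynomial.eval₂_eq_eval_map,
    Polynomial.eval_add_of_sq_eq_zero _ _ _ (by rw [sq, inr_mul_inr]),
    Polynomial.derivative_map, ← Polynomial.eval₂_eq_eval_map, ← Polynomial.eval₂_eq_eval_map,
    key, key] at h2
  have h3 := congrArg snd h2
  simpa [hF'] using h3

/-- The **Jacobian criterion**: if polynomials are algebraically independent, then their
differentials at a generic real point are linearly independent. -/
theorem surjective_polyDifferential [Finite κ] {x : σ → ℝ} (hx : AlgebraicIndependent ℚ x)
    {P : κ → MvPolynomial σ ℚ}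
    (hP : AlgebraicIndependent ℚ fun k => MvPolynomial.aeval x (P k)) :
    Function.Surjective fun (ξ : σ → ℝ) (k : κ) => polyDifferential x (P k) ξ := by
  have : Fintype κ := Fintype.ofFinite κ
  let y : κ → ℝ := fun k => MvPolynomial.aeval x (P k)
  obtain ⟨I, hI, hyI⟩ := hP.indep_range.subset_isBasis_of_subset
    (show Set.range y ⊆ Set.range y ∪ Set.range x from Set.subset_union_left)
  let J : Set σ := {j | x j ∈ I ∧ x j ∉ Set.range y}
  let Q : κ ⊕ J → MvPolynomial σ ℚ := Sum.elim P (fun j => MvPolynomial.X j.1)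
  have hQI : (Set.range fun k => MvPolynomial.aeval x (Q k)) = I := by
    ext a
    constructor
    · rintro ⟨k | j, rfl⟩
      · exact hyI ⟨k, rfl⟩
      · simpa [Q] using j.2.1
    · intro ha
      rcases Classical.em (a ∈ Set.range y) with ⟨k, hk⟩ | hn
      · exact ⟨Sum.inl k, hk⟩
      · rcases hI.subset ha with h | ⟨j, rfl⟩
        · exact absurd h hn
        · exact ⟨Sum.inr ⟨j, ha, hn⟩, by simp [Q]⟩
  -- Completed by coordinates, the polynomials form a transcendence basis. Their differentials have
  -- no common zero, and there are at most as many of them as coordinates.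
  let Ψ : (σ → ℝ) →ₗ[ℝ] (κ ⊕ J → ℝ) := LinearMap.pi fun k => (polyDifferential x (Q k)).toLinearMap
  have hinj : Function.Injective Ψ := by
    rw [← LinearMap.ker_eq_bot, LinearMap.ker_eq_bot']
    intro ξ hξ
    funext i
    rw [← polyDifferential_X x ξ i]
    refine polyDifferential_eq_zero_of_mem_algClosureOver hx Q _ ?_ fun k => congrFun hξ k
    rw [← SetLike.mem_coe, coe_algClosureOver, hQI, hI.closure_eq_closure]
    exact Matroid.subset_closure _ _ (Set.subset_univ _) (Or.inr ⟨i, by simp⟩)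
  have hQ : AlgebraicIndependent ℚ fun k => MvPolynomial.aeval x (Q k) := by
    refine algebraicIndependent_of_indep_range ?_ (hQI ▸ hI.indep)
    rintro (k | i) (l | j) h
    · exact congrArg Sum.inl (hP.injective h)
    · exact absurd ⟨k, h.trans (by simp [Q])⟩ j.2.2
    · exact absurd ⟨l, h.symm.trans (by simp [Q])⟩ i.2.2
    · exact congrArg Sum.inr (Subtype.ext (hx.injective (by simpa [Q] using h)))
  have hcard : Nat.card (κ ⊕ J) ≤ Nat.card σ := by
    refine hQ.card_le_of_subset (y := x) fun k => ?_
    have : MvPolynomial.aeval x (Q k) ∈ Algebra.adjoin ℚ (Set.range x) := by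
      rw [Algebra.adjoin_range_eq_range_aeval]
      exact ⟨_, rfl⟩
    rw [mem_algClosureOver_iff]
    exact isAlgebraic_algebraMap (⟨_, this⟩ : Algebra.adjoin ℚ (Set.range x))
  have : Fintype J := Fintype.ofFinite J
  have hsurj : Function.Surjective Ψ := by
    have h1 := LinearMap.finrank_le_finrank_of_injective hinj
    have h2 : Module.finrank ℝ (σ → ℝ) = Module.finrank ℝ (κ ⊕ J → ℝ) := by
      refine h1.antisymm ?_
      rw [Module.finrank_pi, Module.finrank_pi]
      simpa using hcard
    exact (LinearMap.injective_iff_surjective_of_finrank_eq_finrank h2).1 hinj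
  intro c
  obtain ⟨ξ, hξ⟩ := hsurj (Sum.elim c 0)
  exact ⟨ξ, funext fun k => congrFun hξ (Sum.inl k)⟩

end RealPoints

/-! ### Squared edge lengths and real rigidity -/

section Lengths

/-- The squared length `∑ᵢ (ρ(u)ᵢ - ρ(v)ᵢ)²` of the pair `{u, v}` in the realization `ρ`, over an
arbitrary commutative ring. -/
def sqLength {R V : Type*} [CommRing R] {d : ℕ} (ρ : V → Fin d → R) (e : Sym2 V) : R :=
  Sym2.lift ⟨fun u v => ∑ i, (ρ u i - ρ v i) ^ 2,
    fun u v => Finset.sum_congr rfl fun i _ => by ring⟩ e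

theorem sqLength_mk {R V : Type*} [CommRing R] {d : ℕ} (ρ : V → Fin d → R) (u v : V) :
    sqLength ρ s(u, v) = ∑ i, (ρ u i - ρ v i) ^ 2 := rfl

theorem map_sqLength {R S V : Type*} [CommRing R] [CommRing S] {d : ℕ} (f : R →+* S)
    (ρ : V → Fin d → R) (e : Sym2 V) :
    f (sqLength ρ e) = sqLength (fun v i => f (ρ v i)) e := by
  induction e with | _ u v => simp [sqLength_mk]

theorem sqLength_map {R V W : Type*} [CommRing R] {d : ℕ} (ρ : V → Fin d → R) (f : W → V)
    (e : Sym2 W) : sqLength ρ (e.map f) = sqLength (fun w => ρ (f w)) e := by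
  induction e with | _ u v => rfl

/-- The squared length of a pair as a polynomial in the coordinates of the realization. -/
noncomputable def lengthPoly {V : Type*} (d : ℕ) (e : Sym2 V) : MvPolynomial (V × Fin d) ℚ :=
  sqLength (fun v i => MvPolynomial.X (v, i)) e

theorem aeval_lengthPoly {K V : Type*} [CommRing K] [Algebra ℚ K] {d : ℕ} (x : V × Fin d → K)
    (e : Sym2 V) : MvPolynomial.aeval x (lengthPoly d e) = sqLength (fun v i => x (v, i)) e := by
  have := map_sqLength (MvPolynomial.aeval x : MvPolynomial (V × Fin d) ℚ →ₐ[ℚ] K).toRingHom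
    (fun v i => MvPolynomial.X (v, i)) e
  simpa [lengthPoly] using this

end Lengths

section Rigidity

variable {V : Type*} {d : ℕ}

theorem norm_sub_eq_iff_sqLength_eq (ρ σ : V → EuclideanSpace ℝ (Fin d)) (u v : V) :
    ‖ρ u - ρ v‖ = ‖σ u - σ v‖ ↔
      sqLength (fun v i => ρ v i) s(u, v) = sqLength (fun v i => σ v i) s(u, v) := by
  rw [← sq_eq_sq₀ (norm_nonneg _) (norm_nonneg _), EuclideanSpace.norm_sq_eq,
    EuclideanSpace.norm_sq_eq]
  simp [sqLength_mk]

/-- The realization in Euclidean space with given coordinates. -/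
def ofCoordinates (x : V × Fin d → ℝ) (v : V) : EuclideanSpace ℝ (Fin d) :=
  WithLp.toLp 2 fun i => x (v, i)

variable [Finite V]

theorem eventually_norm_ofCoordinates_sub_lt (x : V × Fin d → ℝ) {ε : ℝ} (hε : 0 < ε) :
    ∀ᶠ z in nhds x, ∀ v, ‖ofCoordinates x v - ofCoordinates z v‖ < ε := by
  rw [Filter.eventually_all]
  intro v
  have hc : Continuous fun z : V × Fin d → ℝ => ‖ofCoordinates x v - ofCoordinates z v‖ := by
    unfold ofCoordinates
    fun_prop
  exact hc.continuousAt.eventually_lt continuousAt_const (by simpa using hε)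

/-- Rigidity in terms of coordinates and squared lengths. -/
theorem IsRigid.eventually_sqLength_eq {G : SimpleGraph V} (hG : IsRigid d G) {x : V × Fin d → ℝ}
    (hx : AlgebraicIndependent ℚ x) :
    ∀ᶠ z in nhds x, (∀ e ∈ G.edgeSet, sqLength (fun v i => z (v, i)) e =
        sqLength (fun v i => x (v, i)) e) →
      ∀ e, sqLength (fun v i => z (v, i)) e = sqLength (fun v i => x (v, i)) e := by
  obtain ⟨ε, hε, h⟩ := hG (ofCoordinates x) hx
  filter_upwards [eventually_norm_ofCoordinates_sub_lt x hε] with z hz he e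
  induction e with
  | _ u v =>
    refine (norm_sub_eq_iff_sqLength_eq (ofCoordinates z) (ofCoordinates x) u v).1
      (h (ofCoordinates z) (fun u v huv => ?_) hz u v)
    exact (norm_sub_eq_iff_sqLength_eq (ofCoordinates z) (ofCoordinates x) u v).2 (he _ huv)

/-- In a rigid graph, at a generic point, the lengths of all pairs are algebraic over the edge
lengths: otherwise an independent set of edges together with some pair would have independent
differentials, and the pair could be deformed while keeping all edge lengths. -/
theorem IsRigid.sqLength_mem_algClosureOver {G : SimpleGraph V} (hG : IsRigid d G)
    {x : V × Fin d → ℝ} (hx : AlgebraicIndependent ℚ x) (e : Sym2 V) :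
    sqLength (fun v i => x (v, i)) e ∈
      algClosureOver ((fun e => sqLength (fun v i => x (v, i)) e) '' G.edgeSet) := by
  have : Fintype V := Fintype.ofFinite V
  by_contra hcon
  set ℓ : Sym2 V → ℝ := fun e => sqLength (fun v i => x (v, i)) e with hℓ
  obtain ⟨I, hI⟩ := (AlgebraicIndependent.matroid ℚ ℝ).exists_isBasis (ℓ '' G.edgeSet)
  have hIcl : algClosureOver I = algClosureOver (ℓ '' G.edgeSet) := by
    apply SetLike.coe_injective
    rw [coe_algClosureOver, coe_algClosureOver, hI.closure_eq_closure]
  have hIfin : Finite I := ((Set.toFinite G.edgeSet).image ℓ).subset hI.subset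
  choose f hf hfI using fun a : I => hI.subset a.2
  let P : Option I → MvPolynomial (V × Fin d) ℚ := fun o => o.elim (lengthPoly d e)
    fun a => lengthPoly d (f a)
  have hPval : (fun o => MvPolynomial.aeval x (P o)) = fun o => o.elim (ℓ e) ((↑) : I → ℝ) := by
    funext o
    cases o with
    | none => exact aeval_lengthPoly x e
    | some a => exact (aeval_lengthPoly x (f a)).trans (hfI a)
  have hPind : AlgebraicIndependent ℚ fun o => MvPolynomial.aeval x (P o) := by
    rw [hPval, AlgebraicIndependent.option_iff]
    refine ⟨hI.indep, ?_⟩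
    rw [← hIcl, mem_algClosureOver_iff] at hcon
    rwa [Subtype.range_val]
  have hsurj := surjective_polyDifferential hx hPind
  have : Fintype I := Fintype.ofFinite I
  have hstrict : HasStrictFDerivAt (fun (z : V × Fin d → ℝ) o => MvPolynomial.aeval z (P o))
      (ContinuousLinearMap.pi fun o => polyDifferential x (P o)) x :=
    hasStrictFDerivAt_pi.2 fun o => hasStrictFDerivAt_aeval x (P o)
  have hmap := hstrict.map_nhds_eq_of_surj (LinearMap.range_eq_top.2 hsurj)
  have hroot : ∀ᶠ z in nhds x, ∀ e' : G.edgeSet,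
      (∀ a : I, MvPolynomial.aeval z (lengthPoly d (f a)) =
        MvPolynomial.aeval x (lengthPoly d (f a))) →
      MvPolynomial.aeval z (lengthPoly d e'.1) = MvPolynomial.aeval x (lengthPoly d e'.1) := by
    rw [Filter.eventually_all]
    intro e'
    refine eventually_aeval_eq_of_mem_algClosureOver hx _ _ ?_
    have h1 : (Set.range fun a : I => MvPolynomial.aeval x (lengthPoly d (f a))) = I := by
      simp_rw [aeval_lengthPoly]
      ext b
      exact ⟨by rintro ⟨a, rfl⟩; exact Set.mem_of_eq_of_mem (hfI a) a.2,
        fun hb => ⟨⟨b, hb⟩, hfI ⟨b, hb⟩⟩⟩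
    rw [h1, hIcl, aeval_lengthPoly]
    exact subset_algClosureOver _ ⟨e', e'.2, rfl⟩
  have hgood := hroot.and (hG.eventually_sqLength_eq hx)
  have himage := Filter.image_mem_map (m := fun (z : V × Fin d → ℝ) o =>
    MvPolynomial.aeval z (P o)) hgood
  rw [hmap] at himage
  classical
  -- Change the value at the extra pair only.
  have hcont : Continuous fun δ : ℝ => (fun o => MvPolynomial.aeval x (P o)) +
      δ • (Pi.single none 1 : Option I → ℝ) := by fun_prop
  have h0 : (fun δ : ℝ => (fun o => MvPolynomial.aeval x (P o)) +
      δ • (Pi.single none 1 : Option I → ℝ)) 0 = fun o => MvPolynomial.aeval x (P o) := by simp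
  have hev := hcont.continuousAt.preimage_mem_nhds (h0.symm ▸ himage)
  obtain ⟨δ, ⟨z, ⟨hz1, hz2⟩, hz⟩, hδ⟩ :=
    ((Filter.Eventually.filter_mono nhdsWithin_le_nhds hev).and
      (self_mem_nhdsWithin : {(0 : ℝ)}ᶜ ∈ nhdsWithin 0 {(0 : ℝ)}ᶜ)).exists
  have hsome : ∀ a : I, MvPolynomial.aeval z (lengthPoly d (f a)) =
      MvPolynomial.aeval x (lengthPoly d (f a)) := fun a => by
    simpa [P] using congrFun hz (some a)
  have hnone := congrFun hz none
  have hedge := hz2 (fun e' he' => by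
    simpa [aeval_lengthPoly] using hz1 ⟨e', he'⟩ hsome) e
  simp [P, aeval_lengthPoly, hedge] at hnone
  exact hδ hnone

/-- The edge lengths of a minimally rigid graph are algebraically independent: if one of them were
algebraic over the others, then the graph without this edge would be rigid. -/
theorem IsMinimallyRigid.algebraicIndependent_lengthPoly {G : SimpleGraph V}
    (hG : IsMinimallyRigid d G) :
    AlgebraicIndependent ℚ fun e : G.edgeSet => lengthPoly d e.1 := by
  have : Fintype V := Fintype.ofFinite V
  by_contra hcon
  -- An independent set `t` of edges and a further edge `e` that depends on it.
  obtain ⟨t, e, het, ht, hdep⟩ : ∃ (t : Set G.edgeSet) (e : G.edgeSet), e ∉ t ∧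
      AlgebraicIndepOn ℚ (fun e : G.edgeSet => lengthPoly d e.1) t ∧
      ¬ AlgebraicIndepOn ℚ (fun e : G.edgeSet => lengthPoly d e.1) (insert e t) := by
    by_contra! hall
    refine hcon (algebraicIndependent_of_finite_type' (MvPolynomial.C_injective _ _)
      fun t _ ht e het => ?_)
    exact ((AlgebraicIndepOn.insert_iff het).1 (hall t e het ht)).2
  refine hG.2 e.1 e.2 fun ρ hρ => ?_
  set x : V × Fin d → ℝ := fun p => ρ p.1 p.2 with hx
  have htr := fun s : Set G.edgeSet =>
    algebraicIndependent_aeval_iff hρ fun e' : s => lengthPoly d e'.1.1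
  have halg : MvPolynomial.aeval x (lengthPoly d e.1) ∈ algClosureOver
      (Set.range fun e' : t => MvPolynomial.aeval x (lengthPoly d e'.1.1)) := by
    by_contra hno
    refine hdep ((htr (insert e t)).1 ?_)
    refine (AlgebraicIndepOn.insert_iff (R := ℚ)
      (x := fun e' : G.edgeSet => MvPolynomial.aeval x (lengthPoly d e'.1)) het).2
      ⟨(htr t).2 ht, ?_⟩
    rw [mem_algClosureOver_iff] at hno
    rwa [Set.image_eq_range]
  have hev := (eventually_aeval_eq_of_mem_algClosureOver hρ _ _ halg).and
    (hG.1.eventually_sqLength_eq hρ)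
  obtain ⟨ε, hε, hball⟩ := Metric.eventually_nhds_iff.1 hev
  refine ⟨ε, hε, fun ρ' hρ' hclose u v => ?_⟩
  obtain ⟨h1, h2⟩ := @hball (fun p => ρ' p.1 p.2) (by
    rw [dist_pi_lt_iff hε]
    intro p
    refine lt_of_le_of_lt ?_ (hclose p.1)
    rw [dist_comm, Real.dist_eq, ← Real.norm_eq_abs]
    exact PiLp.norm_apply_le (ρ p.1 - ρ' p.1) p.2)
  have hlen : ∀ e' ∈ G.edgeSet, e' ≠ e.1 → sqLength (fun v i => ρ' v i) e' =
      sqLength (fun v i => ρ v i) e' := by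
    intro e' he' hne
    induction e' with
    | _ a b =>
      exact (norm_sub_eq_iff_sqLength_eq ρ' ρ a b).1 (hρ' a b (by
        rw [SimpleGraph.deleteEdges_adj]
        exact ⟨he', hne⟩))
  refine (norm_sub_eq_iff_sqLength_eq ρ' ρ u v).2 (h2 (fun e' he' => ?_) _)
  rcases eq_or_ne e' e.1 with rfl | hne
  · simp only [aeval_lengthPoly] at h1
    exact h1 fun a => hlen _ a.1.2 fun h => het (Subtype.ext h ▸ a.2)
  · exact hlen e' he' hne

end Rigidity

/-! ### Rigid graphs have enough edges -/

section EdgeCount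

variable {V : Type*} {d : ℕ}

/-- If a vertex `o` sits at the origin, then all inner products are polarizations of lengths. -/
theorem sum_mul_mem_algClosureOver {K : Type*} [Field K] [CharZero K] {σ : V → Fin d → K}
    {s : Set K} (hs : ∀ e, sqLength σ e ∈ algClosureOver s) {o : V} (ho : ∀ i, σ o i = 0)
    (v w : V) : ∑ i, σ v i * σ w i ∈ algClosureOver s := by
  have h : ∑ i, σ v i * σ w i =
      (sqLength σ s(v, o) + sqLength σ s(w, o) - sqLength σ s(v, w)) / 2 := by
    rw [eq_div_iff two_ne_zero]
    simp only [sqLength_mk, ho, sub_zero, Finset.sum_mul, ← Finset.sum_add_distrib,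
      ← Finset.sum_sub_distrib]
    exact Finset.sum_congr rfl fun i _ => by ring
  rw [h]
  exact div_mem (sub_mem (add_mem (hs _) (hs _)) (hs _)) (ofNat_mem _ 2)

/-- The part of the point `x` below the staircase: the vertex number `j` keeps only its first
`j` coordinates. By the Gram-Schmidt process, this is a normal form of realizations in Euclidean
space up to isometries. -/
noncomputable def staircase {K : Type*} [Zero K] {n : ℕ} (e : V ≃ Fin n) (x : V × Fin d → K)
    (v : V) (i : Fin d) : K :=
  if i.val < (e v).val then x (v, i) else 0

/-- The coordinates of a generic staircase realization are algebraic over its lengths. The proof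
is a Cholesky decomposition: the row `i` is determined by the previous rows and by the inner
products with the vertex number `i + 1`, whose coordinates vanish after `i`. -/
theorem staircase_mem_algClosureOver {K : Type*} [Field K] [CharZero K] {n : ℕ} (e : V ≃ Fin n)
    {x : V × Fin d → K} (hx : ∀ p, x p ≠ 0) {s : Set K}
    (hs : ∀ e', sqLength (staircase e x) e' ∈ algClosureOver s) (v : V) (i : Fin d) :
    staircase e x v i ∈ algClosureOver s := by
  obtain ⟨i, hi⟩ := i
  induction i using Nat.strong_induction_on generalizing v with
  | _ i ih =>
    by_cases hin : i + 1 < n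
    · let w : V := e.symm ⟨i + 1, hin⟩
      let o : V := e.symm ⟨0, by omega⟩
      have ho : ∀ j, staircase e x o j = 0 := fun j => by simp [staircase, o]
      have hw : staircase e x w ⟨i, hi⟩ ≠ 0 := by simpa [staircase, w] using hx _
      -- Inner products with `w` only involve the rows up to `i`.
      have hsum : ∀ u, ∑ j, staircase e x u j * staircase e x w j =
          ∑ j with j < (⟨i, hi⟩ : Fin d), staircase e x u j * staircase e x w j +
            staircase e x u ⟨i, hi⟩ * staircase e x w ⟨i, hi⟩ := by
        intro u
        rw [← Finset.sum_filter_add_sum_filter_not Finset.univ (fun j => j < (⟨i, hi⟩ : Fin d))]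
        congr 1
        refine Finset.sum_eq_single_of_mem _ (by simp) fun j hj hji => ?_
        have : staircase e x w j = 0 := by
          simp only [Finset.mem_filter, Finset.mem_univ, true_and, Fin.lt_def, not_lt] at hj
          have : j.val ≠ i := fun h => hji (Fin.ext h)
          simp only [staircase, w, Equiv.apply_symm_apply]
          rw [if_neg]
          omega
        rw [this, mul_zero]
      have hmul : ∀ u, staircase e x u ⟨i, hi⟩ * staircase e x w ⟨i, hi⟩ ∈ algClosureOver s := by
        intro u
        rw [← sub_eq_of_eq_add' (hsum u)]
        refine sub_mem (sum_mul_mem_algClosureOver hs ho u w) (sum_mem fun j hj => ?_)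
        have hj' : j.val < i := by simpa [Fin.lt_def] using hj
        exact mul_mem (ih j hj' u j.2) (ih j hj' w j.2)
      have hwmem : staircase e x w ⟨i, hi⟩ ∈ algClosureOver s :=
        mem_algClosureOver_of_sq_mem (by rw [sq]; exact hmul w)
      rw [← mul_div_cancel_right₀ (staircase e x v ⟨i, hi⟩) hw]
      exact div_mem (hmul v) hwmem
    · have : staircase e x v ⟨i, hi⟩ = 0 := by
        have := (e v).2
        simp only [staircase]
        rw [if_neg]
        omega
      rw [this]
      exact zero_mem _

/-- The dimension of the space of realizations of `n` points in `d`-space up to isometries. It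
equals `d n - d (d + 1) / 2` for `d ≤ n`, but the sum is correct for all `n` and is evidently
monotone in `d`. -/
def rigidRank (n d : ℕ) : ℕ := ∑ j ∈ Finset.range n, min j d

/-- The staircase has as many entries as the space of realizations up to isometries has
dimensions. -/
theorem card_staircase {n : ℕ} (e : V ≃ Fin n) :
    Nat.card {p : V × Fin d // p.2.val < (e p.1).val} = rigidRank n d := by
  have : Fintype V := Fintype.ofEquiv _ e.symm
  rw [Nat.card_congr (Equiv.subtypeProdEquivSigmaSubtype
    fun (v : V) (i : Fin d) => i.val < (e v).val), Nat.card_sigma, rigidRank,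
    ← Fin.sum_univ_eq_sum_range fun j => min j d, ← e.sum_comp]
  refine Finset.sum_congr rfl fun v _ => ?_
  rw [Nat.card_eq_fintype_card, Fintype.card_subtype, Fin.card_filter_val_lt, min_comm]

/-- A rigid graph has at least `rigidRank` edges: the lengths of a staircase realization, hence
those of a generic one, contain that many algebraically independent ones, and in a rigid graph they are
all algebraic over the edge lengths. -/
theorem IsRigid.rigidRank_le_card_edgeSet [Finite V] {G : SimpleGraph V} (hG : IsRigid d G) :
    rigidRank (Nat.card V) d ≤ Nat.card G.edgeSet := by
  obtain ⟨x, hx⟩ := exists_algebraicIndependent_real (V × Fin d)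
  let e := Finite.equivFin V
  let σ := staircase e x
  obtain ⟨I, hI⟩ := (AlgebraicIndependent.matroid ℚ ℝ).exists_isBasis (Set.range (sqLength σ))
  have hIfin : Finite I := (Set.finite_range (sqLength σ)).subset hI.subset
  choose f hf using fun a : I => hI.subset a.2
  have h1 : Nat.card {p : V × Fin d // p.2.val < (e p.1).val} ≤ Nat.card I := by
    have hS : AlgebraicIndependent ℚ
        fun p : {p : V × Fin d // p.2.val < (e p.1).val} => x p.1 :=
      hx.comp _ Subtype.val_injective
    refine hS.card_le_of_subset (y := ((↑) : I → ℝ)) fun p => ?_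
    have hp : x p.1 = σ p.1.1 p.1.2 := by simp [σ, staircase, p.2]
    rw [hp, Subtype.range_val]
    refine staircase_mem_algClosureOver e hx.ne_zero (fun e' => ?_) _ _
    rw [← SetLike.mem_coe, coe_algClosureOver, hI.closure_eq_closure]
    exact Matroid.subset_closure _ _ (Set.subset_univ _) ⟨e', rfl⟩
  have h2 : AlgebraicIndependent ℚ fun a : I => lengthPoly d (f a) := by
    refine AlgebraicIndependent.of_comp
      (MvPolynomial.aeval fun p : V × Fin d => σ p.1 p.2 : MvPolynomial (V × Fin d) ℚ →ₐ[ℚ] ℝ) ?_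
    have hval : (MvPolynomial.aeval fun p : V × Fin d => σ p.1 p.2) ∘
        (fun a : I => lengthPoly d (f a)) = ((↑) : I → ℝ) :=
      funext fun a => (aeval_lengthPoly _ _).trans (hf a)
    rw [hval]
    exact hI.indep
  have h3 := ((algebraicIndependent_aeval_iff hx _).2 h2).card_le_of_subset
    (y := fun e' : G.edgeSet => sqLength (fun v i => x (v, i)) e'.1) fun a => by
      rw [aeval_lengthPoly, ← Set.image_eq_range]
      exact hG.sqLength_mem_algClosureOver hx _
  rw [← card_staircase e]
  exact h1.trans h3

end EdgeCount

/-! ### Frames of a realization -/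

section Frames

variable {U : Type*} {d k : ℕ}

/-- The vectors from the vertex `o` to the vertices `b i` in the realization `σ`, as the rows of a
matrix. -/
def frameMatrix {R : Type*} [CommRing R] (σ : U → Fin d → R) (o : U) (b : Fin k → U) :
    Matrix (Fin k) (Fin d) R :=
  Matrix.of fun i l => σ (b i) l - σ o l

/-- The Gram matrix of the vectors from `o` to the `b i`. -/
def frameGram {R : Type*} [CommRing R] (σ : U → Fin d → R) (o : U) (b : Fin k → U) :
    Matrix (Fin k) (Fin k) R :=
  frameMatrix σ o b * (frameMatrix σ o b).transpose

/-- The affine coordinates `c` express all vertices of `σ` in terms of `o` and the `b i`. -/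
def IsFrameCoord {R : Type*} [CommRing R] (σ : U → Fin d → R) (o : U) (b : Fin k → U)
    (c : U → Fin k → R) : Prop :=
  ∀ v l, σ v l - σ o l = ∑ i, c v i * frameMatrix σ o b i l

theorem frameGram_apply_comm {R : Type*} [CommRing R] (σ : U → Fin d → R) (o : U)
    (b : Fin k → U) (i j : Fin k) : frameGram σ o b i j = frameGram σ o b j i := by
  simp only [frameGram, Matrix.mul_apply, Matrix.transpose_apply]
  exact Finset.sum_congr rfl fun _ _ => mul_comm _ _

theorem map_frameGram {R S : Type*} [CommRing R] [CommRing S] (f : R →+* S) (σ : U → Fin d → R)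
    (o : U) (b : Fin k → U) (i j : Fin k) :
    f (frameGram σ o b i j) = frameGram (fun v l => f (σ v l)) o b i j := by
  simp [frameGram, Matrix.mul_apply, frameMatrix]

theorem IsFrameCoord.map {R S : Type*} [CommRing R] [CommRing S] (f : R →+* S)
    {σ : U → Fin d → R} {o : U} {b : Fin k → U} {c : U → Fin k → R} (h : IsFrameCoord σ o b c) :
    IsFrameCoord (fun v l => f (σ v l)) o b (fun v i => f (c v i)) := by
  intro v l
  have := congrArg f (h v l)
  simpa [frameMatrix] using this

/-- The parameters of a realization with respect to the frame `o, b`: the Gram matrix of the frame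
and the coordinates of the vertices outside the frame. They determine all lengths. -/
def frameParam {R : Type*} [CommRing R] (σ : U → Fin d → R) (o : U) (b : Fin k → U)
    (c : U → Fin k → R) :
    Sym2 (Fin k) ⊕ {v : U // v ∉ insert o (Set.range b)} × Fin k → R :=
  Sum.elim (Sym2.lift ⟨frameGram σ o b, frameGram_apply_comm σ o b⟩) fun p => c p.1 p.2

theorem map_frameParam {R S : Type*} [CommRing R] [CommRing S] (f : R →+* S) (σ : U → Fin d → R)
    (o : U) (b : Fin k → U) (c : U → Fin k → R)
    (p : Sym2 (Fin k) ⊕ {v : U // v ∉ insert o (Set.range b)} × Fin k) :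
    f (frameParam σ o b c p) =
      frameParam (fun v l => f (σ v l)) o b (fun v i => f (c v i)) p := by
  rcases p with p | ⟨v, i⟩
  · induction p with | _ i j => exact map_frameGram f σ o b i j
  · rfl

theorem sqLength_eq_sum_frameGram {R : Type*} [CommRing R] {σ : U → Fin d → R} {o : U}
    {b : Fin k → U} {c : U → Fin k → R} (h : IsFrameCoord σ o b c) (u v : U) :
    sqLength σ s(u, v) =
      ∑ i, ∑ j, (c u i - c v i) * (c u j - c v j) * frameGram σ o b i j := by
  have h1 : ∀ l, σ u l - σ v l = ∑ i, (c u i - c v i) * frameMatrix σ o b i l := fun l => by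
    rw [← sub_sub_sub_cancel_right _ _ (σ o l), h, h, ← Finset.sum_sub_distrib]
    exact Finset.sum_congr rfl fun i _ => by ring
  simp only [sqLength_mk, h1, sq, Finset.sum_mul_sum]
  simp only [frameGram, Matrix.mul_apply, Matrix.transpose_apply, Finset.mul_sum]
  rw [Finset.sum_comm]
  refine Finset.sum_congr rfl fun i _ => ?_
  rw [Finset.sum_comm]
  exact Finset.sum_congr rfl fun j _ => Finset.sum_congr rfl fun l _ => by ring

theorem IsFrameCoord.apply_origin {K : Type*} [Field K] {σ : U → Fin d → K} {o : U}
    {b : Fin k → U} {c : U → Fin k → K} (h : IsFrameCoord σ o b c)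
    (hli : LinearIndependent K (frameMatrix σ o b).row) (i : Fin k) : c o i = 0 := by
  refine Fintype.linearIndependent_iff.1 hli (c o) (funext fun l => ?_) i
  have := h o l
  rw [sub_self] at this
  simpa [Finset.sum_apply] using this.symm

theorem IsFrameCoord.apply_frame {K : Type*} [Field K] {σ : U → Fin d → K} {o : U}
    {b : Fin k → U} {c : U → Fin k → K} (h : IsFrameCoord σ o b c)
    (hli : LinearIndependent K (frameMatrix σ o b).row) (j i : Fin k) :
    c (b j) i = if i = j then 1 else 0 := by
  rw [← sub_eq_zero]
  refine Fintype.linearIndependent_iff.1 hli (fun i => c (b j) i - if i = j then 1 else 0)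
    (funext fun l => ?_) i
  have := h (b j) l
  simp only [Finset.sum_apply, Pi.smul_apply, smul_eq_mul, sub_mul, Finset.sum_sub_distrib,
    Matrix.row, ite_mul, one_mul, zero_mul, Finset.sum_ite_eq', Finset.mem_univ, if_true,
    Pi.zero_apply]
  rw [← this]
  simp [frameMatrix]

/-- Two realizations with the same parameters have the same coordinates. -/
theorem IsFrameCoord.eq_of_frameParam_eq {K : Type*} [Field K] {σ τ : U → Fin d → K} {o : U}
    {b : Fin k → U} {c c' : U → Fin k → K} (h : IsFrameCoord σ o b c) (h' : IsFrameCoord τ o b c')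
    (hli : LinearIndependent K (frameMatrix σ o b).row)
    (hli' : LinearIndependent K (frameMatrix τ o b).row)
    (heq : frameParam σ o b c = frameParam τ o b c') : c = c' := by
  funext v i
  by_cases hv : v ∈ insert o (Set.range b)
  · rcases hv with rfl | ⟨j, rfl⟩
    · rw [h.apply_origin hli, h'.apply_origin hli']
    · rw [h.apply_frame hli, h'.apply_frame hli']
  · exact congrFun heq (Sum.inr (⟨v, hv⟩, i))

theorem frameGram_eq_of_frameParam_eq {R : Type*} [CommRing R] {σ τ : U → Fin d → R} {o : U}
    {b : Fin k → U} {c c' : U → Fin k → R} (heq : frameParam σ o b c = frameParam τ o b c') :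
    frameGram σ o b = frameGram τ o b := by
  ext i j
  exact congrFun heq (Sum.inl s(i, j))

theorem linearIndependent_of_det_frameGram_ne_zero {K : Type*} [Field K] {σ : U → Fin d → K}
    {o : U} {b : Fin k → U} (h : (frameGram σ o b).det ≠ 0) :
    LinearIndependent K (frameMatrix σ o b).row := by
  rw [Fintype.linearIndependent_iff]
  intro g hg
  have h1 : Matrix.vecMul g (frameMatrix σ o b) = 0 := by
    rw [← hg]
    ext l
    simp [Matrix.vecMul, dotProduct, Finset.sum_apply, Matrix.row]
  have h2 : Matrix.vecMul g (frameGram σ o b) = 0 := by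
    rw [frameGram, ← Matrix.vecMul_vecMul, h1, Matrix.zero_vecMul]
  exact congrFun (Matrix.eq_zero_of_vecMul_eq_zero h h2)

/-- All lengths lie in the field generated by the parameters. -/
theorem sqLength_mem_algClosureOver_frameParam {K : Type*} [Field K] [CharZero K]
    {σ : U → Fin d → K} {o : U} {b : Fin k → U} {c : U → Fin k → K} (h : IsFrameCoord σ o b c)
    (hli : LinearIndependent K (frameMatrix σ o b).row) {s : Set K}
    (hs : Set.range (frameParam σ o b c) ⊆ s) (e : Sym2 U) :
    sqLength σ e ∈ algClosureOver s := by
  have hmem : ∀ p, frameParam σ o b c p ∈ algClosureOver s := fun p =>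
    subset_algClosureOver s (hs ⟨p, rfl⟩)
  have hc : ∀ v i, c v i ∈ algClosureOver s := by
    intro v i
    by_cases hv : v ∈ insert o (Set.range b)
    · rcases hv with rfl | ⟨j, rfl⟩
      · rw [h.apply_origin hli]
        exact zero_mem _
      · rw [h.apply_frame hli]
        split_ifs
        · exact one_mem _
        · exact zero_mem _
    · exact hmem (Sum.inr (⟨v, hv⟩, i))
  induction e with
  | _ u v =>
    rw [sqLength_eq_sum_frameGram h]
    refine sum_mem fun i _ => sum_mem fun j _ => mul_mem (mul_mem ?_ ?_) ?_
    · exact sub_mem (hc _ _) (hc _ _)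
    · exact sub_mem (hc _ _) (hc _ _)
    · exact hmem (Sum.inl s(i, j))

theorem injective_of_linearIndependent_frameMatrix {K : Type*} [Field K] {σ : U → Fin d → K}
    {o : U} {b : Fin k → U} (hli : LinearIndependent K (frameMatrix σ o b).row) :
    Function.Injective b ∧ o ∉ Set.range b := by
  constructor
  · intro i j hij
    refine hli.injective (funext fun l => ?_)
    simp [frameMatrix, hij]
  · rintro ⟨i, hi⟩
    refine hli.ne_zero i (funext fun l => ?_)
    simp [frameMatrix, hi]

theorem rigidRank_succ_self (k : ℕ) : rigidRank (k + 1) k = (k + 1).choose 2 := by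
  rw [rigidRank, Nat.choose_two_right, ← Finset.sum_range_id]
  exact Finset.sum_congr rfl fun j hj => min_eq_left (by
    have := Finset.mem_range.1 hj
    omega)

theorem card_frameParam_index [Finite U] {o : U} {b : Fin k → U} (hb : Function.Injective b)
    (ho : o ∉ Set.range b) :
    k + 1 ≤ Nat.card U ∧
    Nat.card (Sym2 (Fin k) ⊕ {v : U // v ∉ insert o (Set.range b)} × Fin k) =
      rigidRank (Nat.card U) k := by
  have h1 : (insert o (Set.range b)).ncard = k + 1 := by
    rw [Set.ncard_insert_of_notMem ho (Set.toFinite _), ← Set.image_univ,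
      Set.ncard_image_of_injective _ hb, Set.ncard_univ, Nat.card_fin]
  have h2 := Set.ncard_add_ncard_compl (insert o (Set.range b))
  rw [h1] at h2
  have h3 : Nat.card {v : U // v ∉ insert o (Set.range b)} =
      (insert o (Set.range b))ᶜ.ncard := rfl
  refine ⟨by omega, ?_⟩
  rw [Nat.card_sum, Nat.card_prod, h3, ← h2, Nat.card_fin, Nat.card_eq_fintype_card, Sym2.card,
    Fintype.card_fin]
  induction (insert o (Set.range b))ᶜ.ncard with
  | zero => simp [rigidRank_succ_self]
  | succ m ih =>
    rw [← add_assoc, rigidRank, Finset.sum_range_succ, ← rigidRank, ← ih,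
      min_eq_right (by omega)]
    ring

/-- Every realization has a frame: vertices that form an affine basis of its affine span. -/
theorem exists_frame {K : Type*} [Field K] [Nonempty U] [Finite U] (σ : U → Fin d → K) :
    ∃ (k : ℕ) (o : U) (b : Fin k → U) (c : U → Fin k → K), k ≤ d ∧ IsFrameCoord σ o b c ∧
      LinearIndependent K (frameMatrix σ o b).row := by
  obtain ⟨o⟩ := ‹Nonempty U›
  obtain ⟨κ, a, ha, hspan, hli⟩ := exists_linearIndependent' K fun v => σ v - σ o
  have : Finite κ := Finite.of_injective a ha
  let e := Finite.equivFin κ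
  let b : Fin (Nat.card κ) → U := fun i => a (e.symm i)
  have hrow : (frameMatrix σ o b).row = ((fun v => σ v - σ o) ∘ a) ∘ e.symm := rfl
  have hli' : LinearIndependent K (frameMatrix σ o b).row := by
    rw [hrow]
    exact hli.comp _ e.symm.injective
  have hmem : ∀ v, ∃ c : Fin (Nat.card κ) → K,
      ∑ i, c i • (frameMatrix σ o b).row i = σ v - σ o := by
    intro v
    rw [← Submodule.mem_span_range_iff_exists_fun, hrow, e.symm.surjective.range_comp, hspan]
    exact Submodule.subset_span ⟨v, rfl⟩
  choose c hc using hmem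
  refine ⟨Nat.card κ, o, b, c, ?_, fun v l => ?_, hli'⟩
  · simpa using hli'.fintype_card_le_finrank
  · have := congrFun (hc v) l
    simpa [Finset.sum_apply] using this.symm

/-- Linearly independent frame vectors admit affine coordinates for all vertices as soon as the
frame spans the space or exhausts the vertices. -/
theorem exists_isFrameCoord {K : Type*} [Field K] [Finite U] {σ : U → Fin d → K} {o : U}
    {b : Fin k → U} (hli : LinearIndependent K (frameMatrix σ o b).row)
    (hk : k = d ∨ k + 1 = Nat.card U) : ∃ c : U → Fin k → K, IsFrameCoord σ o b c := by
  suffices h : ∀ v, ∃ c : Fin k → K, ∑ i, c i • (frameMatrix σ o b).row i = σ v - σ o by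
    choose c hc using h
    refine ⟨c, fun v l => ?_⟩
    have := congrFun (hc v) l
    simpa [Finset.sum_apply] using this.symm
  intro v
  rw [← Submodule.mem_span_range_iff_exists_fun]
  rcases hk with rfl | hk
  · rw [hli.span_eq_top_of_card_eq_finrank' (by simp)]
    trivial
  · obtain ⟨hb, ho⟩ := injective_of_linearIndependent_frameMatrix hli
    have hall : insert o (Set.range b) = Set.univ := by
      refine Set.eq_of_subset_of_ncard_le (Set.subset_univ _) ?_ (Set.toFinite _)
      rw [Set.ncard_insert_of_notMem ho (Set.toFinite _), ← Set.image_univ,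
        Set.ncard_image_of_injective _ hb, Set.ncard_univ, Set.ncard_univ, Nat.card_fin, hk]
    rcases hall.symm ▸ Set.mem_univ v with rfl | ⟨i, rfl⟩
    · simp
    · exact Submodule.subset_span ⟨i, rfl⟩

/-- At a generic point every frame is nondegenerate. -/
theorem det_frameGram_ne_zero {ρ : U → Fin d → ℂ} (hρ : IsGenericComplex ρ) {o : U}
    {b : Fin k → U} (hb : Function.Injective b) (ho : o ∉ Set.range b) (hk : k ≤ d) :
    (frameGram ρ o b).det ≠ 0 := by
  classical
  let X : U → Fin d → MvPolynomial (U × Fin d) ℚ := fun v l => MvPolynomial.X (v, l)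
  have hX : (frameGram X o b).det ≠ 0 := by
    -- Specialize the `b i` to the standard unit vectors and `o` to the origin.
    intro h0
    let z : U × Fin d → ℚ := fun p => if ∃ i : Fin k, b i = p.1 ∧ i.val = p.2.val then 1 else 0
    have h1 := congrArg (MvPolynomial.aeval z : _ →ₐ[ℚ] ℚ).toRingHom h0
    rw [RingHom.map_det, map_zero] at h1
    refine one_ne_zero (Eq.trans ?_ h1)
    rw [← Matrix.det_one (n := Fin k)]
    congr 1
    ext i j
    rw [RingHom.mapMatrix_apply, Matrix.map_apply, map_frameGram]
    have hM : ∀ (i : Fin k) (l : Fin d), frameMatrix (fun v l =>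
        (MvPolynomial.aeval z : _ →ₐ[ℚ] ℚ).toRingHom (X v l)) o b i l =
          if l = Fin.castLE hk i then 1 else 0 := by
      intro i l
      have h3 : ¬ ∃ i : Fin k, b i = o ∧ i.val = l.val := fun ⟨i, hi, _⟩ => ho ⟨i, hi⟩
      have h4 : (∃ i' : Fin k, b i' = b i ∧ i'.val = l.val) ↔ l = Fin.castLE hk i :=
        ⟨fun ⟨i', hi', hl⟩ => by rw [hb hi'] at hl; exact Fin.ext hl.symm,
          fun hl => ⟨i, rfl, by rw [hl]; rfl⟩⟩
      simp [frameMatrix, X, z, h3, h4]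
    simp only [frameGram, Matrix.mul_apply, Matrix.transpose_apply, hM]
    rw [Matrix.one_apply, Finset.sum_eq_single (Fin.castLE hk i) (fun l _ hl => by simp [hl])
      (by simp)]
    simp [Fin.ext_iff]
  have h2 := (map_ne_zero_iff (MvPolynomial.aeval fun p : U × Fin d => ρ p.1 p.2 :
    MvPolynomial (U × Fin d) ℚ →ₐ[ℚ] ℂ).toRingHom
    (algebraicIndependent_iff_injective_aeval.1 hρ)).2 hX
  rw [RingHom.map_det] at h2
  convert h2 using 2
  ext i j
  rw [RingHom.mapMatrix_apply, Matrix.map_apply, map_frameGram]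
  simp [X]

end Frames

/-! ### Congruence of realizations with the same parameters -/

section Congruence

variable {U : Type*} {d k : ℕ}

theorem sqLength_orthogonal {A : Matrix (Fin d) (Fin d) ℂ} (hA : A.transpose * A = 1)
    {ρ σ : U → Fin d → ℂ} {t : Fin d → ℂ} (h : ∀ v, σ v = A.mulVec (ρ v) + t) (e : Sym2 U) :
    sqLength σ e = sqLength ρ e := by
  induction e with
  | _ u v =>
    have h1 : ∀ x : Fin d → ℂ, ∑ i, x i ^ 2 = x ⬝ᵥ x := fun x => by
      simp [dotProduct, sq]
    have h2 : σ u - σ v = A.mulVec (ρ u - ρ v) := by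
      rw [h, h, Matrix.mulVec_sub]
      abel
    have h3 : sqLength σ s(u, v) = (σ u - σ v) ⬝ᵥ (σ u - σ v) := h1 _
    have h4 : sqLength ρ s(u, v) = (ρ u - ρ v) ⬝ᵥ (ρ u - ρ v) := h1 _
    rw [h3, h4, h2, Matrix.dotProduct_mulVec, Matrix.vecMul_mulVec, hA, Matrix.vecMul_one]

/-- Two bases of `ℂ^d` with the same Gram matrix differ by an orthogonal matrix. -/
theorem exists_orthogonal_of_gram_eq {X Y : Matrix (Fin d) (Fin d) ℂ}
    (h : X * X.transpose = Y * Y.transpose) (hX : X.det ≠ 0) :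
    ∃ A : Matrix (Fin d) (Fin d) ℂ, A.transpose * A = 1 ∧ ∀ i, A.mulVec (X i) = Y i := by
  -- The map taking the rows of `X` to those of `Y` is `Yᵀ (Xᵀ)⁻¹`.
  have hu : IsUnit X.det := hX.isUnit
  have hut : IsUnit X.transpose.det := by rwa [Matrix.det_transpose]
  refine ⟨Y.transpose * X.transpose⁻¹, ?_, fun i => ?_⟩
  · rw [Matrix.transpose_mul, Matrix.transpose_transpose, Matrix.transpose_nonsing_inv,
      Matrix.transpose_transpose, Matrix.mul_assoc, ← Matrix.mul_assoc Y, ← h, Matrix.mul_assoc X,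
      Matrix.mul_nonsing_inv _ hut, Matrix.mul_one, Matrix.nonsing_inv_mul _ hu]
  · have h1 : (Y.transpose * X.transpose⁻¹) * X.transpose = Y.transpose := by
      rw [Matrix.mul_assoc, Matrix.nonsing_inv_mul _ hut, Matrix.mul_one]
    funext l
    exact congrFun (congrFun h1 l) i

/-- A nondegenerate family of `k` vectors in `ℂ^(k+1)` has a normal vector of square one. -/
theorem exists_unit_normal {X : Matrix (Fin k) (Fin (k + 1)) ℂ} (hX : (X * X.transpose).det ≠ 0) :
    ∃ w : Fin (k + 1) → ℂ, X.mulVec w = 0 ∧ w ⬝ᵥ w = 1 := by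
  obtain ⟨w, hw, hw0⟩ : ∃ w, X.mulVec w = 0 ∧ w ≠ 0 := by
    obtain ⟨w, hw, hw0⟩ := Submodule.exists_mem_ne_zero_of_ne_bot
      (LinearMap.ker_ne_bot_of_finrank_lt (f := X.mulVecLin) (by simp))
    exact ⟨w, hw, hw0⟩
  have hq : w ⬝ᵥ w ≠ 0 := by
    -- Otherwise `w` would be orthogonal to all vectors: they are sums of a combination of the rows
    -- of `X` and of a vector in the kernel of `X`, which is spanned by `w`.
    intro hq
    have hu : IsUnit (X * X.transpose).det := hX.isUnit
    have hproj : ∀ y : Fin k → ℂ,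
        X.mulVec (X.transpose.mulVec ((X * X.transpose)⁻¹.mulVec y)) = y := fun y => by
      rw [Matrix.mulVec_mulVec, Matrix.mulVec_mulVec, Matrix.mul_nonsing_inv _ hu,
        Matrix.one_mulVec]
    have hrange : LinearMap.range X.mulVecLin = ⊤ :=
      LinearMap.range_eq_top.2 fun y => ⟨_, hproj y⟩
    have hker : Module.finrank ℂ (LinearMap.ker X.mulVecLin) = 1 := by
      have := LinearMap.finrank_range_add_finrank_ker X.mulVecLin
      rw [hrange, finrank_top, Module.finrank_fin_fun, Module.finrank_fin_fun] at this
      omega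
    have hspan := (finrank_eq_one_iff_of_nonzero' (⟨w, hw⟩ : LinearMap.ker X.mulVecLin)
      (fun h => hw0 (congrArg Subtype.val h))).1 hker
    refine hw0 (dotProduct_eq_zero w fun u => ?_)
    let a := (X * X.transpose)⁻¹.mulVec (X.mulVec u)
    obtain ⟨r, hr⟩ := hspan ⟨u - X.transpose.mulVec a, by
      rw [LinearMap.mem_ker, Matrix.mulVecLin_apply, Matrix.mulVec_sub, hproj, sub_self]⟩
    have hu' : u = X.transpose.mulVec a + r • w := by
      have := congrArg Subtype.val hr
      have h1 : r • w = u - X.transpose.mulVec a := this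
      rw [h1]
      abel
    rw [hu', dotProduct_add, dotProduct_smul, hq, smul_zero, add_zero, Matrix.dotProduct_mulVec,
      Matrix.vecMul_transpose, hw, zero_dotProduct]
  obtain ⟨z, hz⟩ := IsAlgClosed.exists_pow_nat_eq (w ⬝ᵥ w) two_pos
  have hz0 : z ≠ 0 := by
    rintro rfl
    exact hq (by rw [← hz]; simp)
  refine ⟨z⁻¹ • w, by rw [Matrix.mulVec_smul, hw, smul_zero], ?_⟩
  rw [smul_dotProduct, dotProduct_smul, ← hz, smul_eq_mul, smul_eq_mul]
  field_simp

/-- The square matrix obtained by adding the row `w` below `X`. -/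
def snocRow (X : Matrix (Fin k) (Fin (k + 1)) ℂ) (w : Fin (k + 1) → ℂ) :
    Matrix (Fin (k + 1)) (Fin (k + 1)) ℂ :=
  Fin.snoc (α := fun _ => Fin (k + 1) → ℂ) X w

theorem snocRow_castSucc (X : Matrix (Fin k) (Fin (k + 1)) ℂ) (w : Fin (k + 1) → ℂ) (i : Fin k) :
    snocRow X w i.castSucc = X i :=
  Fin.snoc_castSucc (α := fun _ => Fin (k + 1) → ℂ) _ _ _

theorem snocRow_last (X : Matrix (Fin k) (Fin (k + 1)) ℂ) (w : Fin (k + 1) → ℂ) :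
    snocRow X w (Fin.last k) = w :=
  Fin.snoc_last (α := fun _ => Fin (k + 1) → ℂ) _ _

theorem gram_snocRow {X : Matrix (Fin k) (Fin (k + 1)) ℂ} {w : Fin (k + 1) → ℂ}
    (hw : X.mulVec w = 0) (hw1 : w ⬝ᵥ w = 1) :
    (∀ i j : Fin k, (snocRow X w * (snocRow X w).transpose) i.castSucc j.castSucc =
      (X * X.transpose) i j) ∧
    (∀ i : Fin k, (snocRow X w * (snocRow X w).transpose) i.castSucc (Fin.last k) = 0) ∧
    (∀ j : Fin k, (snocRow X w * (snocRow X w).transpose) (Fin.last k) j.castSucc = 0) ∧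
    (snocRow X w * (snocRow X w).transpose) (Fin.last k) (Fin.last k) = 1 := by
  have h1 : ∀ i, ∑ l, X i l * w l = 0 := fun i => congrFun hw i
  have h2 : ∀ i, ∑ l, w l * X i l = 0 := fun i => by
    rw [← h1 i]
    exact Finset.sum_congr rfl fun l _ => mul_comm _ _
  have h3 : ∑ l, w l * w l = 1 := hw1
  simp [Matrix.mul_apply, snocRow_castSucc, snocRow_last, h1, h2, h3]

/-- The special case of Witt's theorem for nondegenerate families of codimension at most one. -/
theorem exists_orthogonal_of_nondegenerate {X Y : Matrix (Fin k) (Fin d) ℂ}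
    (h : X * X.transpose = Y * Y.transpose) (hX : (X * X.transpose).det ≠ 0)
    (hk : k = d ∨ k + 1 = d) :
    ∃ A : Matrix (Fin d) (Fin d) ℂ, A.transpose * A = 1 ∧ ∀ i, A.mulVec (X i) = Y i := by
  rcases hk with rfl | rfl
  · refine exists_orthogonal_of_gram_eq h ?_
    rw [Matrix.det_mul] at hX
    exact left_ne_zero_of_mul hX
  · obtain ⟨w, hw, hw1⟩ := exists_unit_normal hX
    obtain ⟨w', hw', hw1'⟩ := exists_unit_normal (h ▸ hX)
    obtain ⟨hX1, hX2, hX3, hX4⟩ := gram_snocRow hw hw1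
    obtain ⟨hY1, hY2, hY3, hY4⟩ := gram_snocRow hw' hw1'
    have hgram : snocRow X w * (snocRow X w).transpose =
        snocRow Y w' * (snocRow Y w').transpose := by
      ext i j
      induction i using Fin.lastCases with
      | last =>
        induction j using Fin.lastCases with
        | last => rw [hX4, hY4]
        | cast j => rw [hX3, hY3]
      | cast i =>
        induction j using Fin.lastCases with
        | last => rw [hX2, hY2]
        | cast j => rw [hX1, hY1, h]
    have hdet : (snocRow X w).det ≠ 0 := by
      intro h0
      obtain ⟨v, hv0, hv⟩ := Matrix.exists_vecMul_eq_zero_iff.2 h0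
      have hv' : Matrix.vecMul v (snocRow X w * (snocRow X w).transpose) = 0 := by
        rw [← Matrix.vecMul_vecMul, hv, Matrix.zero_vecMul]
      have hlast : v (Fin.last k) = 0 := by
        have := congrFun hv' (Fin.last k)
        simpa only [Matrix.vecMul, dotProduct, Fin.sum_univ_castSucc, hX2, hX4,
          mul_zero, Finset.sum_const_zero, zero_add, mul_one, Pi.zero_apply] using this
      have hinit : (fun i : Fin k => v i.castSucc) = 0 := by
        refine Matrix.eq_zero_of_vecMul_eq_zero hX (funext fun j => ?_)
        have := congrFun hv' j.castSucc
        simpa only [Matrix.vecMul, dotProduct, Fin.sum_univ_castSucc, hX1, hX3,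
          mul_zero, add_zero, Pi.zero_apply] using this
      refine hv0 (funext fun i => ?_)
      induction i using Fin.lastCases with
      | last => exact hlast
      | cast i => exact congrFun hinit i
    obtain ⟨A, hA, hAX⟩ := exists_orthogonal_of_gram_eq hgram hdet
    refine ⟨A, hA, fun i => ?_⟩
    have := hAX i.castSucc
    rwa [snocRow_castSucc, snocRow_castSucc] at this

/-- Realizations with the same parameters, with respect to a nondegenerate frame, differ by an
isometry. -/
theorem exists_isometry_of_frameParam_eq {σ τ : U → Fin d → ℂ} {o : U} {b : Fin k → U}
    {c c' : U → Fin k → ℂ} (h : IsFrameCoord σ o b c) (h' : IsFrameCoord τ o b c')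
    (hdet : (frameGram σ o b).det ≠ 0) (hk : k = d ∨ k + 1 = d)
    (heq : frameParam σ o b c = frameParam τ o b c') :
    ∃ (A : Matrix (Fin d) (Fin d) ℂ) (t : Fin d → ℂ),
      A.transpose * A = 1 ∧ ∀ v, τ v = A.mulVec (σ v) + t := by
  have hgram := frameGram_eq_of_frameParam_eq heq
  have hcc := h.eq_of_frameParam_eq h' (linearIndependent_of_det_frameGram_ne_zero hdet)
    (linearIndependent_of_det_frameGram_ne_zero (hgram ▸ hdet)) heq
  subst hcc
  obtain ⟨A, hA, hAX⟩ := exists_orthogonal_of_nondegenerate hgram hdet hk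
  refine ⟨A, τ o - A.mulVec (σ o), hA, fun v => ?_⟩
  have h1 : σ v = σ o + ∑ i, c v i • frameMatrix σ o b i := by
    funext l
    have := h v l
    simp only [Pi.add_apply, Finset.sum_apply, Pi.smul_apply, smul_eq_mul, ← this]
    ring
  have h2 : τ v = τ o + ∑ i, c v i • frameMatrix τ o b i := by
    funext l
    have := h' v l
    simp only [Pi.add_apply, Finset.sum_apply, Pi.smul_apply, smul_eq_mul, ← this]
    ring
  rw [h1, h2, Matrix.mulVec_add, Matrix.mulVec_sum]
  simp only [Matrix.mulVec_smul, hAX]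
  abel

end Congruence

/-! ### Transitivity of field automorphisms on equivalent realizations -/

section Transitivity

variable {U : Type*} {d : ℕ}

/-- The reflection of `ℂ^d` that changes the sign of the first coordinate. -/
def reflection (d : ℕ) : Matrix (Fin d) (Fin d) ℂ :=
  Matrix.diagonal fun i => if i.val = 0 then -1 else 1

theorem reflection_transpose_mul_self : (reflection d).transpose * reflection d = 1 := by
  rw [reflection, Matrix.diagonal_transpose, Matrix.diagonal_mul_diagonal, ← Matrix.diagonal_one]
  congr 1
  funext i
  split_ifs <;> simp

theorem det_reflection (hd : 1 ≤ d) : (reflection d).det = -1 := by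
  obtain ⟨m, rfl⟩ : ∃ m, d = m + 1 := ⟨d - 1, by omega⟩
  rw [reflection, Matrix.det_diagonal, Fin.prod_univ_succ]
  simp

theorem map_reflection_mulVec (γ : ℂ ≃+* ℂ) (x : Fin d → ℂ) :
    (fun i => γ ((reflection d).mulVec x i)) = (reflection d).mulVec fun i => γ (x i) := by
  funext i
  simp only [reflection, Matrix.mulVec_diagonal, map_mul]
  split_ifs <;> simp

/-- An isometry that reverses the orientation is a direct isometry after a reflection. -/
theorem directlyCongruent_reflection (hd : 1 ≤ d) {A : Matrix (Fin d) (Fin d) ℂ}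
    (hA : A.transpose * A = 1) (hdet : A.det = -1) {ρ σ : U → Fin d → ℂ} {t : Fin d → ℂ}
    (h : ∀ v, σ v = A.mulVec (ρ v) + t) :
    DirectlyCongruent (fun v => (reflection d).mulVec (ρ v)) σ := by
  refine ⟨A * reflection d, t, ?_, ?_, fun v => ?_⟩
  · rw [Matrix.transpose_mul, Matrix.mul_assoc, ← Matrix.mul_assoc A.transpose, hA,
      Matrix.one_mul, reflection_transpose_mul_self]
  · rw [Matrix.det_mul, hdet, det_reflection hd]
    norm_num
  · have h1 : reflection d * reflection d = 1 := by
      have := reflection_transpose_mul_self (d := d)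
      rwa [reflection, Matrix.diagonal_transpose] at this
    rw [Matrix.mulVec_mulVec, Matrix.mul_assoc, h1, Matrix.mul_one]
    exact h v

theorem det_eq_one_or_neg_one {A : Matrix (Fin d) (Fin d) ℂ} (hA : A.transpose * A = 1) :
    A.det = 1 ∨ A.det = -1 := by
  have h1 := congrArg Matrix.det hA
  rw [Matrix.det_mul, Matrix.det_transpose, Matrix.det_one] at h1
  exact mul_self_eq_one_iff.1 h1

theorem det_frameGram_map_ne_zero (γ : ℂ ≃+* ℂ) {k : ℕ} {ρ : U → Fin d → ℂ} {o : U}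
    {b : Fin k → U} (h : (frameGram ρ o b).det ≠ 0) :
    (frameGram (fun v i => γ (ρ v i)) o b).det ≠ 0 := by
  have h1 := (map_ne_zero_iff γ.toRingHom γ.injective).2 h
  rw [RingHom.map_det] at h1
  convert h1 using 2
  ext i j
  exact (map_frameGram γ.toRingHom ρ o b i j).symm

/-- The mirror image of a generic realization is generic, hence conjugate to it. -/
theorem IsGenericComplex.exists_ringEquiv_reflection [Finite U] {ρ : U → Fin d → ℂ}
    (hρ : IsGenericComplex ρ) :
    ∃ s : ℂ ≃+* ℂ, ∀ v, (fun i => s (ρ v i)) = (reflection d).mulVec (ρ v) := by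
  have h : AlgebraicIndependent ℚ fun p : U × Fin d => (reflection d).mulVec (ρ p.1) p.2 := by
    refine hρ.of_card_le (fun p => ?_) le_rfl
    have h1 := subset_algClosureOver (Set.range fun p : U × Fin d =>
      (reflection d).mulVec (ρ p.1) p.2) ⟨p, rfl⟩
    simp only [reflection, Matrix.mulVec_diagonal, SetLike.mem_coe] at h1 ⊢
    split_ifs at h1
    · simpa using neg_mem h1
    · simpa using h1
  obtain ⟨s, hs⟩ := exists_ringEquiv_of_algebraicIndependent hρ h
  exact ⟨s, fun v => funext fun i => hs (v, i)⟩

theorem rigidRank_lt {n k d : ℕ} (hk : k < d) (hn : k + 1 < n) : rigidRank n k < rigidRank n d := by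
  refine Finset.sum_lt_sum (fun j _ => min_le_min_left j hk.le) ⟨k + 1, by simpa using hn, ?_⟩
  omega

theorem rigidRank_mono {n k d : ℕ} (hk : k ≤ d) : rigidRank n k ≤ rigidRank n d :=
  Finset.sum_le_sum fun j _ => min_le_min_left j hk

/-- If a family `ζ` is algebraically independent together with the edge lengths, then it is so
together with the parameters of the realization, which are as many as the edges. -/
theorem algebraicIndependent_frameParam [Finite U] {H : SimpleGraph U} {k : ℕ}
    {σ : U → Fin d → ℂ} {o : U} {b : Fin k → U} {c : U → Fin k → ℂ} (h : IsFrameCoord σ o b c)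
    (hli : LinearIndependent ℂ (frameMatrix σ o b).row)
    (hE : rigidRank (Nat.card U) k ≤ Nat.card H.edgeSet) {κ : Type*} [Finite κ] {ζ : κ → ℂ}
    (hind : AlgebraicIndependent ℚ (Sum.elim (fun e : H.edgeSet => sqLength σ e.1) ζ)) :
    AlgebraicIndependent ℚ (Sum.elim (frameParam σ o b c) ζ) := by
  obtain ⟨hb, ho⟩ := injective_of_linearIndependent_frameMatrix hli
  refine hind.of_card_le ?_ ?_
  · rintro (e | j)
    · refine sqLength_mem_algClosureOver_frameParam h hli ?_ e.1
      rintro _ ⟨p, rfl⟩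
      exact ⟨Sum.inl p, rfl⟩
    · exact subset_algClosureOver _ ⟨Sum.inr j, rfl⟩
  · rw [Nat.card_sum, (card_frameParam_index hb ho).2, Nat.card_sum]
    omega

/-- If the edge lengths of a graph with at least `rigidRank` edges are algebraically independent,
then every frame is as large as the dimension or the number of vertices permits. -/
theorem frame_size_eq [Finite U] {H : SimpleGraph U} {k : ℕ} {σ : U → Fin d → ℂ} {o : U}
    {b : Fin k → U} {c : U → Fin k → ℂ} (h : IsFrameCoord σ o b c)
    (hli : LinearIndependent ℂ (frameMatrix σ o b).row) (hkd : k ≤ d)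
    (hE : rigidRank (Nat.card U) d ≤ Nat.card H.edgeSet)
    (hind : AlgebraicIndependent ℚ fun e : H.edgeSet => sqLength σ e.1) :
    k = d ∨ k + 1 = Nat.card U := by
  obtain ⟨hb, ho⟩ := injective_of_linearIndependent_frameMatrix hli
  obtain ⟨hkU, hcard⟩ := card_frameParam_index hb ho
  have h1 := hind.card_le_of_subset (y := frameParam σ o b c) fun e =>
    sqLength_mem_algClosureOver_frameParam h hli subset_rfl e.1
  rw [hcard] at h1
  by_contra! hcon
  exact absurd (hE.trans h1) (not_le_of_gt (rigidRank_lt (by omega) (by omega)))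

/-- **Transitivity.** Let `ρ` be generic and `σ` equivalent to `ρ`. Then an automorphism of `ℂ`
takes `ρ` to a realization directly congruent to `σ`, and it can be chosen to fix numbers `ζ` that
are algebraically independent together with the edge lengths. The automorphism comes from the
parameters of the two realizations in a common frame, both of which are algebraically independent;
the automorphism `s` serves to adjust the orientation. -/
theorem exists_ringEquiv_directlyCongruent [Finite U] (hd : 1 ≤ d) (hU : d ≤ Nat.card U)
    {H : SimpleGraph U} (hE : rigidRank (Nat.card U) d ≤ Nat.card H.edgeSet)
    {ρ σ : U → Fin d → ℂ} (hρ : IsGenericComplex ρ)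
    (hσ : ∀ e ∈ H.edgeSet, sqLength σ e = sqLength ρ e) {κ : Type*} [Finite κ] {ζ : κ → ℂ}
    (hind : AlgebraicIndependent ℚ (Sum.elim (fun e : H.edgeSet => sqLength ρ e.1) ζ))
    (s : ℂ ≃+* ℂ) (hsζ : ∀ j, s (ζ j) = ζ j)
    (hsρ : ∀ v, (fun i => s (ρ v i)) = (reflection d).mulVec (ρ v)) :
    ∃ γ : ℂ ≃+* ℂ, (∀ j, γ (ζ j) = ζ j) ∧ DirectlyCongruent (fun v i => γ (ρ v i)) σ := by
  have : Nonempty U := (Nat.card_pos_iff.1 (hd.trans hU)).1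
  have hlen : (fun e : H.edgeSet => sqLength σ e.1) = fun e : H.edgeSet => sqLength ρ e.1 :=
    funext fun e => hσ e.1 e.2
  obtain ⟨k, o, b, c, hkd, hc, hli⟩ := exists_frame σ
  have hk := frame_size_eq hc hli hkd hE
    (hlen ▸ hind.comp Sum.inl Sum.inl_injective)
  obtain ⟨hb, ho⟩ := injective_of_linearIndependent_frameMatrix hli
  have hdet := det_frameGram_ne_zero hρ hb ho hkd
  have hliρ := linearIndependent_of_det_frameGram_ne_zero hdet
  obtain ⟨c', hc'⟩ := exists_isFrameCoord hliρ hk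
  have hE' := (rigidRank_mono hkd).trans hE
  obtain ⟨γ, hγ⟩ := exists_ringEquiv_of_algebraicIndependent
    (algebraicIndependent_frameParam hc' hliρ hE' hind)
    (algebraicIndependent_frameParam hc hli hE' (hlen.symm ▸ hind))
  have hγζ : ∀ j, γ (ζ j) = ζ j := fun j => hγ (Sum.inr j)
  have hγP : frameParam (fun v i => γ (ρ v i)) o b (fun v i => γ (c' v i)) =
      frameParam σ o b c := by
    funext p
    exact (map_frameParam γ.toRingHom ρ o b c' p).symm.trans (hγ (Sum.inl p))
  obtain ⟨A, t, hA, hAt⟩ := exists_isometry_of_frameParam_eq (hc'.map γ.toRingHom) hc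
    (det_frameGram_map_ne_zero γ hdet) (by omega) hγP
  rcases det_eq_one_or_neg_one hA with h1 | h1
  · exact ⟨γ, hγζ, A, t, hA, h1, hAt⟩
  · refine ⟨s.trans γ, fun j => by simp [hsζ, hγζ], ?_⟩
    have h2 : (fun v i => (s.trans γ) (ρ v i)) =
        fun v => (reflection d).mulVec fun i => γ (ρ v i) := by
      funext v
      rw [← map_reflection_mulVec, ← hsρ v]
      rfl
    rw [h2]
    exact directlyCongruent_reflection hd hA h1 hAt

end Transitivity

/-! ### Finiteness of the number of realizations -/

section Conjugation

variable {V : Type*} {d : ℕ}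

theorem DirectlyCongruent.map (γ : ℂ ≃+* ℂ) {ρ σ : V → Fin d → ℂ} (h : DirectlyCongruent ρ σ) :
    DirectlyCongruent (fun v i => γ (ρ v i)) (fun v i => γ (σ v i)) := by
  obtain ⟨A, t, hA, hdet, h⟩ := h
  refine ⟨A.map γ, fun i => γ (t i), ?_, ?_, fun v => funext fun i => ?_⟩
  · have h1 := congrArg (fun M : Matrix (Fin d) (Fin d) ℂ => γ.toRingHom.mapMatrix M) hA
    simpa [Matrix.transpose_map] using h1
  · have h1 := congrArg γ.toRingHom hdet
    rw [RingHom.map_det] at h1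
    simpa using h1
  · simp [h v, Matrix.mulVec, dotProduct]

theorem equivalent_iff_sqLength_eq {G : SimpleGraph V} {ρ σ : V → Fin d → ℂ} :
    (∀ u v, G.Adj u v → sqNorm (σ u - σ v) = sqNorm (ρ u - ρ v)) ↔
      ∀ e ∈ G.edgeSet, sqLength σ e = sqLength ρ e := by
  constructor
  · intro h e he
    induction e with | _ u v => exact h u v he
  · exact fun h u v huv => h s(u, v) huv

/-- A field automorphism that takes the edge lengths of `ρ` to those of `ρ'` takes realizations
equivalent to `ρ` to realizations equivalent to `ρ'`. -/
def conjRealization {G : SimpleGraph V} {ρ ρ' : V → Fin d → ℂ} (γ : ℂ ≃+* ℂ)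
    (h : ∀ e ∈ G.edgeSet, γ (sqLength ρ e) = sqLength ρ' e) (σ : EquivalentRealization G ρ) :
    EquivalentRealization G ρ' :=
  ⟨fun v i => γ (σ.1 v i), equivalent_iff_sqLength_eq.2 fun e he => by
    rw [← h e he, ← equivalent_iff_sqLength_eq.1 σ.2 e he]
    exact (map_sqLength γ.toRingHom σ.1 e).symm⟩

/-- The action of a field automorphism on classes of realizations. -/
def conjClass {G : SimpleGraph V} {ρ ρ' : V → Fin d → ℂ} (γ : ℂ ≃+* ℂ)
    (h : ∀ e ∈ G.edgeSet, γ (sqLength ρ e) = sqLength ρ' e) :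
    RealizationClass G ρ ≃ RealizationClass G ρ' where
  toFun := Quotient.map (conjRealization γ h) fun _ _ hc => hc.map γ
  invFun := Quotient.map
    (conjRealization γ.symm fun e he => by rw [← h e he, RingEquiv.symm_apply_apply])
    fun _ _ hc => hc.map γ.symm
  left_inv := by
    rintro ⟨σ⟩
    refine congrArg (Quotient.mk _) (Subtype.ext (funext fun v => funext fun i => ?_))
    simp [conjRealization]
  right_inv := by
    rintro ⟨σ⟩
    refine congrArg (Quotient.mk _) (Subtype.ext (funext fun v => funext fun i => ?_))
    simp [conjRealization]

/-- Any two generic realizations are conjugate, so their classes correspond. -/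
theorem nonempty_realizationClass_equiv [Finite V] (G : SimpleGraph V) {ρ ρ' : V → Fin d → ℂ}
    (hρ : IsGenericComplex ρ) (hρ' : IsGenericComplex ρ') :
    Nonempty (RealizationClass G ρ ≃ RealizationClass G ρ') := by
  obtain ⟨γ, hγ⟩ := exists_ringEquiv_of_algebraicIndependent hρ hρ'
  refine ⟨conjClass γ fun e _ => ?_⟩
  refine (map_sqLength γ.toRingHom ρ e).trans ?_
  congr 1
  exact funext fun v => funext fun i => hγ (v, i)

end Conjugation

section Finiteness

variable {U : Type*} {d : ℕ}

/-- An element algebraic over `s` has finitely many images under automorphisms that fix `s`. -/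
theorem finite_conjugates {s : Set ℂ} {a : ℂ} (ha : a ∈ algClosureOver s) :
    {z | ∃ γ : ℂ ≃+* ℂ, (∀ x ∈ s, γ x = x) ∧ γ a = z}.Finite := by
  rw [mem_algClosureOver_iff] at ha
  obtain ⟨F, hF0, hF⟩ := ha
  refine (F.rootSet_finite ℂ).subset ?_
  rintro _ ⟨γ, hγ, rfl⟩
  have hfix : ∀ x ∈ Algebra.adjoin ℚ s, γ x = x := fun x hx => by
    induction hx using Algebra.adjoin_induction with
    | mem x hx => exact hγ x hx
    | algebraMap r => simp
    | add x y _ _ hx hy => rw [map_add, hx, hy]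
    | mul x y _ _ hx hy => rw [map_mul, hx, hy]
  let f : ℂ →ₐ[Algebra.adjoin ℚ s] ℂ := { γ.toRingHom with commutes' := fun x => hfix x x.2 }
  rw [Polynomial.mem_rootSet]
  refine ⟨hF0, ?_⟩
  have := Polynomial.aeval_algHom_apply f a F
  rw [hF, map_zero] at this
  exact this

/-- A graph with at least `rigidRank` edges whose lengths are algebraically independent has finitely
many realizations up to direct isometries. They are all conjugate to `ρ`, so their parameters are
conjugates of those of `ρ`, which are algebraic over the edge lengths. The parameters determine a
realization up to an isometry, that is, up to a direct isometry and a reflection. -/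
theorem finite_realizationClass [Finite U] (hd : 1 ≤ d) (hU : d ≤ Nat.card U)
    {H : SimpleGraph U} (hE : rigidRank (Nat.card U) d ≤ Nat.card H.edgeSet)
    {ρ : U → Fin d → ℂ} (hρ : IsGenericComplex ρ)
    (hind : AlgebraicIndependent ℚ fun e : H.edgeSet => sqLength ρ e.1) :
    Finite (RealizationClass H ρ) := by
  have : Nonempty U := (Nat.card_pos_iff.1 (hd.trans hU)).1
  obtain ⟨k, o, b, c, hkd, hc, hli⟩ := exists_frame ρ
  have hk := frame_size_eq hc hli hkd hE hind
  obtain ⟨hb, ho⟩ := injective_of_linearIndependent_frameMatrix hli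
  have hdet := det_frameGram_ne_zero hρ hb ho hkd
  have hP := hind.mem_algClosureOver_of_card_le (y := frameParam ρ o b c)
    (fun e => sqLength_mem_algClosureOver_frameParam hc hli subset_rfl e.1)
    (by rw [(card_frameParam_index hb ho).2]; exact (rigidRank_mono hkd).trans hE)
  obtain ⟨s, hs⟩ := hρ.exists_ringEquiv_reflection
  have hrep : ∀ q : RealizationClass H ρ, ∃ (γ : ℂ ≃+* ℂ) (τ : EquivalentRealization H ρ),
      (∀ x ∈ Set.range fun e : H.edgeSet => sqLength ρ e.1, γ x = x) ∧
      τ.1 = (fun v i => γ (ρ v i)) ∧ Quotient.mk _ τ = q := by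
    rintro ⟨σ⟩
    have hind' : AlgebraicIndependent ℚ
        (Sum.elim (fun e : H.edgeSet => sqLength ρ e.1) (Empty.elim : Empty → ℂ)) :=
      (algebraicIndependent_equiv' (Equiv.sumEmpty _ _).symm rfl).1 hind
    obtain ⟨γ, -, hγ⟩ := exists_ringEquiv_directlyCongruent hd hU hE hρ
      (equivalent_iff_sqLength_eq.1 σ.2) hind' s (fun j => j.elim) hs
    have hlen : ∀ e ∈ H.edgeSet, sqLength (fun v i => γ (ρ v i)) e = sqLength ρ e := by
      intro e he
      obtain ⟨A, t, hA, -, hAt⟩ := hγ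
      rw [← sqLength_orthogonal hA hAt, equivalent_iff_sqLength_eq.1 σ.2 e he]
    refine ⟨γ, ⟨fun v i => γ (ρ v i), equivalent_iff_sqLength_eq.2 hlen⟩, ?_, rfl,
      Quotient.sound hγ⟩
    rintro _ ⟨e, rfl⟩
    exact (map_sqLength γ.toRingHom ρ e).trans (hlen e.1 e.2)
  choose γ τ hγ hτ hτq using hrep
  let f : RealizationClass H ρ → (_ → ℂ) := fun q p => γ q (frameParam ρ o b c p)
  let R := fun p => {z | ∃ γ : ℂ ≃+* ℂ, (∀ x ∈ Set.range fun e : H.edgeSet => sqLength ρ e.1,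
    γ x = x) ∧ γ (frameParam ρ o b c p) = z}
  have hR : (Set.univ.pi R).Finite := Set.Finite.pi fun p => finite_conjugates (hP p)
  have huniv : f ⁻¹' (Set.univ.pi R) = Set.univ :=
    Set.eq_univ_of_forall fun q p _ => ⟨γ q, hγ q, rfl⟩
  rw [← Set.finite_univ_iff, ← huniv]
  -- It remains to see that each fibre of the parameter map has at most two elements.
  refine hR.preimage' fun r _ => ?_
  rcases (f ⁻¹' {r}).eq_empty_or_nonempty with h0 | ⟨q₀, hq₀⟩
  · rw [h0]
    exact Set.finite_empty
  -- The mirror image of a representative of the class `q₀`.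
  let μ : EquivalentRealization H ρ := ⟨fun v => (reflection d).mulVec ((τ q₀).1 v),
    equivalent_iff_sqLength_eq.2 fun e he => by
      rw [← equivalent_iff_sqLength_eq.1 (τ q₀).2 e he]
      exact sqLength_orthogonal (t := 0) reflection_transpose_mul_self (fun v => by simp) e⟩
  refine (Set.toFinite {q₀, Quotient.mk _ μ}).subset fun q hq => ?_
  have hparam : frameParam (fun v i => γ q₀ (ρ v i)) o b (fun v i => γ q₀ (c v i)) =
      frameParam (fun v i => γ q (ρ v i)) o b (fun v i => γ q (c v i)) := by
    funext p
    refine (map_frameParam (γ q₀).toRingHom ρ o b c p).symm.trans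
      (Eq.trans ?_ (map_frameParam (γ q).toRingHom ρ o b c p))
    exact congrFun (hq₀.trans hq.symm) p
  obtain ⟨A, t, hA, hAt⟩ := exists_isometry_of_frameParam_eq (hc.map (γ q₀).toRingHom)
    (hc.map (γ q).toRingHom) (det_frameGram_map_ne_zero (γ q₀) hdet) (by omega) hparam
  have hAt' : ∀ v, (τ q).1 v = A.mulVec ((τ q₀).1 v) + t := by
    rw [hτ, hτ]
    exact hAt
  rcases det_eq_one_or_neg_one hA with h1 | h1
  · left
    rw [← hτq q, ← hτq q₀]
    exact (Quotient.sound (show DirectlyCongruent _ _ from ⟨A, t, hA, h1, hAt'⟩)).symm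
  · right
    rw [← hτq q]
    refine (Quotient.sound (show DirectlyCongruent μ.1 (τ q).1 from ?_)).symm
    exact directlyCongruent_reflection hd hA h1 hAt'

/-- If all generic realizations have finitely many classes, the realization number is well
defined. -/
theorem isRealizationNumber_realizationNumber [Finite U] {H : SimpleGraph U}
    (h : ∀ ρ : U → Fin d → ℂ, IsGenericComplex ρ → Finite (RealizationClass H ρ)) :
    IsRealizationNumber d H (realizationNumber d H) := by
  intro ρ hρ
  refine ⟨h ρ hρ, ?_⟩
  obtain ⟨ρ', hρ', heq⟩ := Nat.sInf_mem (s := {c : ℕ | ∃ ρ : U → Fin d → ℂ,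
    IsGenericComplex ρ ∧ c = Nat.card (RealizationClass H ρ)}) ⟨_, ρ, hρ, rfl⟩
  obtain ⟨e⟩ := nonempty_realizationClass_equiv H hρ hρ'
  rw [Nat.card_congr e]
  exact heq.symm

theorem exists_isGenericComplex (U : Type*) [Finite U] (d : ℕ) :
    ∃ ρ : U → Fin d → ℂ, IsGenericComplex ρ := by
  obtain ⟨x, hx⟩ := exists_algebraicIndependent_real (U × Fin d)
  exact ⟨fun v i => x (v, i), hx.map' (f := Complex.ofRealAm.restrictScalars ℚ)
    Complex.ofReal_injective⟩

theorem IsMinimallyRigid.algebraicIndependent_sqLength [Finite U] {H : SimpleGraph U}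
    (hH : IsMinimallyRigid d H) {ρ : U → Fin d → ℂ} (hρ : IsGenericComplex ρ) :
    AlgebraicIndependent ℚ fun e : H.edgeSet => sqLength ρ e.1 := by
  have := (algebraicIndependent_aeval_iff hρ _).2 hH.algebraicIndependent_lengthPoly
  simpa only [aeval_lengthPoly] using this

theorem IsMinimallyRigid.isRealizationNumber [Finite U] (hd : 1 ≤ d) (hU : d ≤ Nat.card U)
    {H : SimpleGraph U} (hH : IsMinimallyRigid d H) :
    IsRealizationNumber d H (realizationNumber d H) :=
  isRealizationNumber_realizationNumber fun _ hρ =>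
    finite_realizationClass hd hU hH.1.rigidRank_le_card_edgeSet hρ
      (hH.algebraicIndependent_sqLength hρ)

end Finiteness

/-! ### Divisibility -/

section Divisibility

variable {V : Type*} {d : ℕ}

theorem IsGenericComplex.restrict {ρ : V → Fin d → ℂ} (hρ : IsGenericComplex ρ) {S : Set V} :
    IsGenericComplex fun u : S => ρ u.1 :=
  hρ.comp (fun p : S × Fin d => (p.1.1, p.2)) fun p p' h => by
    simp only [Prod.mk.injEq] at h
    exact Prod.ext (Subtype.ext h.1) h.2

/-- The restriction of a realization to a subgraph, on classes. -/
def restrictClass {G : SimpleGraph V} (H : G.Subgraph) (ρ : V → Fin d → ℂ) :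
    RealizationClass G ρ → RealizationClass H.coe (fun u => ρ u.1) :=
  Quotient.map (fun σ => ⟨fun u => σ.1 u.1, fun u v huv => σ.2 u.1 v.1 (H.adj_sub huv)⟩)
    fun _ _ ⟨A, t, hA, hdet, h⟩ => ⟨A, t, hA, hdet, fun u => h u.1⟩

/-- If all fibres of a map between finite types are equipotent, then the cardinality of the target
divides that of the source. -/
theorem card_dvd_of_fibers {α β : Type*} [Finite α] [Finite β] (f : α → β) (y₀ : β)
    (h : ∀ y, Nonempty ({x // f x = y₀} ≃ {x // f x = y})) : Nat.card β ∣ Nat.card α := by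
  have : Fintype β := Fintype.ofFinite β
  rw [← Nat.card_congr (Equiv.sigmaFiberEquiv f), Nat.card_sigma,
    Finset.sum_congr rfl fun y _ => (Nat.card_congr (h y).some).symm, Finset.sum_const,
    Finset.card_univ, ← Nat.card_eq_fintype_card, smul_eq_mul]
  exact dvd_mul_right _ _

/-- The classes over `ρ` restricted to `H` are in bijection with the classes over any other
realization of `H` equivalent to it. A field automorphism that takes the one to the other also fixes
the edge lengths outside `H`, so it permutes the realizations of `G`. -/
theorem nonempty_fiber_equiv [Finite V] (hd : 1 ≤ d) {G : SimpleGraph V} (H : G.Subgraph)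
    (hU : d ≤ Nat.card H.verts)
    (hE : rigidRank (Nat.card H.verts) d ≤ Nat.card H.coe.edgeSet)
    {ρ : V → Fin d → ℂ} (hρ : IsGenericComplex ρ)
    (hind : AlgebraicIndependent ℚ fun e : G.edgeSet => sqLength ρ e.1)
    (q : RealizationClass H.coe fun u => ρ u.1) :
    Nonempty ({p // restrictClass H ρ p = Quotient.mk _ ⟨fun u => ρ u.1, fun _ _ _ => rfl⟩} ≃
      {p // restrictClass H ρ p = q}) := by
  obtain ⟨σ⟩ := q
  have hmap : ∀ e ∈ H.coe.edgeSet, e.map Subtype.val ∈ H.edgeSet := by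
    intro e he
    induction e with | _ u v => exact he
  -- The edges of `G` outside `H`.
  let κ := {e : G.edgeSet // e.1 ∉ H.edgeSet}
  let ζ : κ → ℂ := fun e => sqLength ρ e.1.1
  let j : H.coe.edgeSet ⊕ κ → G.edgeSet := Sum.elim
    (fun e => ⟨e.1.map Subtype.val, H.edgeSet_subset (hmap e.1 e.2)⟩) Subtype.val
  have hj : Function.Injective j := by
    rintro (e | e) (e' | e') h
    · exact congrArg Sum.inl (Subtype.ext (Sym2.map.injective Subtype.val_injective
        (congrArg Subtype.val h)))
    · exact absurd (congrArg Subtype.val h ▸ hmap e.1 e.2) e'.2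
    · exact absurd (congrArg Subtype.val h.symm ▸ hmap e'.1 e'.2) e.2
    · exact congrArg Sum.inr (Subtype.ext h)
  have hind' : AlgebraicIndependent ℚ (Sum.elim
      (fun e : H.coe.edgeSet => sqLength (fun u : H.verts => ρ u.1) e.1) ζ) := by
    convert hind.comp j hj using 1
    funext e
    rcases e with e | e
    · exact (sqLength_map ρ Subtype.val e.1).symm
    · rfl
  obtain ⟨s, hs⟩ := hρ.exists_ringEquiv_reflection
  have hsζ : ∀ e, s (ζ e) = ζ e := fun e => by
    refine (map_sqLength s.toRingHom ρ e.1.1).trans ?_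
    exact sqLength_orthogonal (t := 0) reflection_transpose_mul_self
      (fun v => (hs v).trans (add_zero _).symm) e.1.1
  obtain ⟨γ, hγζ, hγ⟩ := exists_ringEquiv_directlyCongruent hd hU hE hρ.restrict
    (equivalent_iff_sqLength_eq.1 σ.2) hind' s hsζ fun u => hs u.1
  have hγH : ∀ e ∈ H.coe.edgeSet, γ (sqLength (fun u : H.verts => ρ u.1) e) =
      sqLength (fun u : H.verts => ρ u.1) e := by
    intro e he
    obtain ⟨A, t, hA, -, hAt⟩ := hγ
    exact (map_sqLength γ.toRingHom _ e).trans
      ((sqLength_orthogonal hA hAt e).symm.trans (equivalent_iff_sqLength_eq.1 σ.2 e he))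
  have hγG : ∀ e ∈ G.edgeSet, γ (sqLength ρ e) = sqLength ρ e := by
    intro e he
    by_cases heH : e ∈ H.edgeSet
    · obtain ⟨e', he', rfl⟩ : ∃ e' ∈ H.coe.edgeSet, e'.map Subtype.val = e := by
        induction e with
        | _ u v => exact ⟨s(⟨u, H.edge_vert heH⟩, ⟨v, H.edge_vert (H.adj_symm heH)⟩), heH, rfl⟩
      rw [sqLength_map]
      exact hγH e' he'
    · exact hγζ ⟨⟨e, he⟩, heH⟩
  refine ⟨(conjClass γ hγG).subtypeEquiv fun p => ?_⟩
  have hcomm : restrictClass H ρ (conjClass γ hγG p) =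
      conjClass γ hγH (restrictClass H ρ p) := by
    obtain ⟨p⟩ := p
    rfl
  have hbase : conjClass γ hγH (Quotient.mk _ ⟨fun u => ρ u.1, fun _ _ _ => rfl⟩) =
      Quotient.mk _ σ := Quotient.sound hγ
  rw [hcomm]
  change _ ↔ _ = Quotient.mk _ σ
  rw [← hbase, (conjClass γ hγH).apply_eq_iff_eq]

end Divisibility

theorem mainTheorem3 {V : Type*} [Finite V] (d : ℕ) (hd : 1 ≤ d)
    (G : SimpleGraph V) (H : G.Subgraph) (hproper : H ≠ ⊤)
    (hcard : d ≤ Nat.card H.verts)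
    (hG : IsMinimallyRigid d G) (hH : IsMinimallyRigid d H.coe) :
    IsRealizationNumber d H.coe (realizationNumber d H.coe) ∧
    IsRealizationNumber d G (realizationNumber d G) ∧
    realizationNumber d H.coe ∣ realizationNumber d G := by
  have hcardV : d ≤ Nat.card V :=
    hcard.trans (Nat.card_le_card_of_injective _ Subtype.val_injective)
  have h1 := hH.isRealizationNumber hd hcard
  have h2 := hG.isRealizationNumber hd hcardV
  refine ⟨h1, h2, ?_⟩
  obtain ⟨ρ, hρ⟩ := exists_isGenericComplex V d
  obtain ⟨hfin, hc⟩ := h1 (fun u => ρ u.1) hρ.restrict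
  obtain ⟨hfin', hc'⟩ := h2 ρ hρ
  rw [← hc, ← hc']
  exact card_dvd_of_fibers (restrictClass H ρ) _
    (nonempty_fiber_equiv hd H hcard hH.1.rigidRank_le_card_edgeSet hρ
      (hG.algebraicIndependent_sqLength hρ))
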